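/- Let $\mathscr{A}$ be a set (the alphabet), let $F$ be a set of finite words over $\mathscr{A}$, and let $X\subseteq\mathscr{A}^{\mathbb N}$ be the subshift of all sequences in which no word of $F$ occurs as a block of consecutive letters. Let $\mathcal{L}_X$ be the language of $X$, i.e. the set of finite words (including the empty word $\omega$) occurring in sequences of $X$, and assume that every letter of $\mathscr{A}$ occurs in some sequence of $X$. For $\alpha,\beta\in\mathcal{L}_X$ put $C(\alpha,\beta)=\{\beta x\in X:\alpha x\in X\}$, and let $\mathcal{U}$ be the Boolean algebra of subsets of $X$ generated by all the sets $C(\alpha,\beta)$, $\alpha,\beta\in\mathcal{L}_X$. For a commutative unital ring $R$, let $\widetilde{\mathcal A}_R(X)$ be the universal unital $R$-algebra with generators $\{p_A:A\in\mathcal{U}\}$ and $\{s_a,s_a^*:a\in\mathscr{A}\}$ subject to the relations (i) $p_X=1$, $p_{A\cap B}=p_Ap_B$, $p_{A\cup B}=p_A+p_B-p_{A\cap B}$ and $p_\emptyset=0$ for all $A,B\in\mathcal{U}$; (ii) $s_as_a^*s_a=s_a$ and $s_a^*s_as_a^*=s_a^*$ for all $a\in\mathscr{A}$; (iii) $s_\beta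 s_\alpha^*s_\alpha s_\beta^*=p_{C(\alpha,\beta)}$ for all $\alpha,\beta\in\mathcal{L}_X$, where $s_\omega=s_\omega^*=1$, $s_\alpha=s_{\alpha_1}\cdots s_{\alpha_n}$ and $s_\alpha^*=s_{\alpha_n}^*\cdots s_{\alpha_1}^*$ for $\alpha=\alpha_1\cdots\alpha_n$. Let $\mathcal{Q}_X$ be the set of irrational paths, i.e. of the one-point sets $\{p\}\in\mathcal{U}$ such that $p\neq\alpha\beta^\infty$ for all $\alpha,\beta\in\mathcal{L}_X$ with $\beta\neq\omega$. Suppose that $R$ is a field and let $I$ be a left ideal of $\widetilde{\mathcal A}_R(X)$. Then $I$ is minimal (that is, $I\neq 0$ and the only left ideal strictly contained in $I$ is $0$) if and only if $I$ is isomorphic, as a left $\widetilde{\mathcal A}_R(X)$-module, to $\widetilde{\mathcal A}_R(X)p_A$ for some $A\in\mathcal{Q}_X$. -/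

import Mathlib

namespace SubshiftAlgebra

universe u v

/-- The subshift of all sequences over the alphabet `𝒜`, none of whose words (finite blocks of
consecutive letters) belongs to the set `F` of forbidden words. -/
def subshift {𝒜 : Type v} (F : Set (List 𝒜)) : Set (Stream' 𝒜) :=
  {x | ∀ k n : ℕ, (x.drop k).take n ∉ F}

/-- The language of `X`: the words `w` that are the initial word of some sequence in `X`.
For a shift-invariant `X` these are the words that occur anywhere in a sequence of `X`. -/
def language {𝒜 : Type v} (X : Set (Stream' 𝒜)) : Set (List 𝒜) :=
  {w | ∃ x ∈ X, x.take w.length = w}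

/-- `C(α, β) = {βx ∈ X : αx ∈ X}`, as a subset of `X`. -/
def C {𝒜 : Type v} (X : Set (Stream' 𝒜)) (α β : List 𝒜) : Set X :=
  {y | ∃ x : Stream' 𝒜, (y : Stream' 𝒜) = β ++ₛ x ∧ α ++ₛ x ∈ X}

/-- The Boolean algebra of subsets of `X` generated by the sets `C(α, β)`, for `α` and `β` in
the language of `X`. -/
def U {𝒜 : Type v} (X : Set (Stream' 𝒜)) : BooleanSubalgebra (Set X) :=
  BooleanSubalgebra.closure {A | ∃ α ∈ language X, ∃ β ∈ language X, A = C X α β}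

theorem C_mem_U {𝒜 : Type v} (X : Set (Stream' 𝒜)) {α β : List 𝒜}
    (hα : α ∈ language X) (hβ : β ∈ language X) : C X α β ∈ U X :=
  BooleanSubalgebra.subset_closure ⟨α, hα, β, hβ, rfl⟩

/-- The irrational paths of `X`: the elements of `U X` of the form `{p}` where `p` is
not of the form `αβ^∞` with `α, β` in the language of `X` (and `β` nonempty, so that the
infinite word `β^∞` makes sense). -/
def irrationalPaths {𝒜 : Type v} (X : Set (Stream' 𝒜)) : Set (U X) :=
  {A | ∃ p : X, (A : Set X) = {p} ∧
    ∀ α ∈ language X, ∀ β ∈ language X, ∀ hβ : β ≠ [],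
      (p : Stream' 𝒜) ≠ α ++ₛ Stream'.cycle β hβ}

/-- The generators `p_A` (`A ∈ U X`), `s_a` and `s_a^*` (`a` a letter). -/
inductive Generator {𝒜 : Type v} (X : Set (Stream' 𝒜)) : Type v
  | p (A : U X) : Generator X
  | s (a : 𝒜) : Generator X
  | sStar (a : 𝒜) : Generator X

section Free

variable (R : Type u) [CommRing R] {𝒜 : Type v} (X : Set (Stream' 𝒜))

/-- `p_A` in the free algebra. -/
def freeP (A : U X) : FreeAlgebra R (Generator X) := FreeAlgebra.ι R (Generator.p A)

/-- `s_a` in the free algebra. -/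
def freeS (a : 𝒜) : FreeAlgebra R (Generator X) := FreeAlgebra.ι R (Generator.s a)

/-- `s_a^*` in the free algebra. -/
def freeSStar (a : 𝒜) : FreeAlgebra R (Generator X) := FreeAlgebra.ι R (Generator.sStar a)

/-- `s_α = s_{α₁} ⋯ s_{αₙ}`, which is `1` for the empty word. -/
def freeSWord (α : List 𝒜) : FreeAlgebra R (Generator X) := (α.map (freeS R X)).prod

/-- `s_α^* = s_{αₙ}^* ⋯ s_{α₁}^*`, which is `1` for the empty word. -/
def freeSStarWord (α : List 𝒜) : FreeAlgebra R (Generator X) :=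
  (α.reverse.map (freeSStar R X)).prod

/-- The defining relations of the unital subshift algebra. -/
inductive Rel : FreeAlgebra R (Generator X) → FreeAlgebra R (Generator X) → Prop
  | p_top : Rel (freeP R X ⊤) 1
  | p_inter (A B : U X) : Rel (freeP R X (A ⊓ B)) (freeP R X A * freeP R X B)
  | p_union (A B : U X) :
      Rel (freeP R X (A ⊔ B)) (freeP R X A + freeP R X B - freeP R X (A ⊓ B))
  | p_bot : Rel (freeP R X ⊥) 0
  | s_sStar_s (a : 𝒜) : Rel (freeS R X a * freeSStar R X a * freeS R X a) (freeS R X a)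
  | sStar_s_sStar (a : 𝒜) :
      Rel (freeSStar R X a * freeS R X a * freeSStar R X a) (freeSStar R X a)
  | word (α β : List 𝒜) (hα : α ∈ language X) (hβ : β ∈ language X) :
      Rel (freeSWord R X β * freeSStarWord R X α * freeSWord R X α * freeSStarWord R X β)
        (freeP R X ⟨C X α β, C_mem_U X hα hβ⟩)

end Free

/-- The unital subshift algebra: the universal unital `R`-algebra with generators
`p_A`, `s_a`, `s_a^*` subject to the relations `Rel`. -/
abbrev UnitalSubshiftAlgebra (R : Type u) [CommRing R] {𝒜 : Type v}
    (X : Set (Stream' 𝒜)) : Type (max u v) :=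
  RingQuot (Rel R X)

/-- The element `p_A` of the unital subshift algebra. -/
def p (R : Type u) [CommRing R] {𝒜 : Type v} (X : Set (Stream' 𝒜)) (A : U X) :
    UnitalSubshiftAlgebra R X :=
  RingQuot.mkAlgHom R (Rel R X) (freeP R X A)

end SubshiftAlgebra

/-!
Let `𝒜_R` be the algebra, and let it act on functions `X → R[T;T⁻¹]`, with `T` recording the
degree of `s_a`. If `x ≠ 0`, then some `a * x * b` is either `c • p_D` with `c ≠ 0` and `D`
nonempty, or lies in `p_{y} 𝒜_R` for an isolated periodic point `y` and has a nonzero matrix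
coefficient at `y`. A minimal left ideal containing `x` is isomorphic to the left ideal generated
by `a * x * b`. If `y = γ^∞`, then `s_γ` has coefficient `T ^ |γ|` at `y`, and `1 - T ^ |γ|` is
neither zero nor a unit, so minimality excludes the periodic points; in the case of `p_D`, it
forces `D` to be a point none of whose tails is periodic, since the left ideals generated by `p_D`
and `p_{x}` are isomorphic if `D = {αx}`.

Conversely, if `D` is an irrational path, then `s_α p_B s_β^*` with `α ≠ β` is annihilated by
compression with `p_D`, so `p_D 𝒜_R p_D = R p_D`. The algebra is semiprime, by the first
part, and hence `𝒜_R p_D` is minimal.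
-/

namespace SubshiftAlgebra

universe u v

section GeneralizedInverses

variable {M : Type*} [Semigroup M]

/-- `u` and `v` are generalized inverses of each other. This is the algebraic counterpart of a
partial isometry `u` with adjoint `v`. -/
def IsGeneralizedInverse (u v : M) : Prop := u * v * u = u ∧ v * u * v = v

theorem IsGeneralizedInverse.mul {u v x y : M} (huv : IsGeneralizedInverse u v)
    (hxy : IsGeneralizedInverse x y) (h : Commute (v * u) (x * y)) :
    IsGeneralizedInverse (u * x) (y * v) := by
  constructor
  · calc u * x * (y * v) * (u * x) = u * (x * y * (v * u)) * x := by simp only [mul_assoc]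
      _ = u * v * u * (x * y * x) := by rw [← h.eq]; simp only [mul_assoc]
      _ = u * x := by rw [huv.1, hxy.1]
  · calc y * v * (u * x) * (y * v) = y * (v * u * (x * y)) * v := by simp only [mul_assoc]
      _ = y * x * y * (v * u * v) := by rw [h.eq]; simp only [mul_assoc]
      _ = y * v := by rw [huv.2, hxy.2]

end GeneralizedInverses

section MinimalLeftIdeals

variable {B : Type*} [Ring B]

theorem isAtom_iff_of_linearEquiv {I J : Ideal B} (e : I ≃ₗ[B] J) : IsAtom I ↔ IsAtom J := by
  rw [← isSimpleModule_iff_isAtom, ← isSimpleModule_iff_isAtom, e.isSimpleModule_iff]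

theorem nonempty_linearEquiv_span_singleton {M N : Type*} [AddCommGroup M] [Module B M]
    [AddCommGroup N] [Module B N] [IsSimpleModule B M] (f : M →ₗ[B] N) {v : M} (h : f v ≠ 0) :
    Nonempty (M ≃ₗ[B] Submodule.span B {f v}) := by
  have hinj : Function.Injective f :=
    f.injective_or_eq_zero.resolve_right fun h0 => h (by rw [h0, LinearMap.zero_apply])
  have hrange : LinearMap.range f = Submodule.span B {f v} := by
    rw [LinearMap.range_eq_map, ← IsSimpleModule.span_singleton_eq_top B
      (ne_of_apply_ne f (h.trans_eq f.map_zero.symm)), Submodule.map_span, Set.image_singleton]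
  exact ⟨(LinearEquiv.ofInjective f hinj).trans (LinearEquiv.ofEq _ _ hrange)⟩

theorem nonempty_linearEquiv_span_mul_mul {I : Ideal B} (hI : IsAtom I) {x : B} (hx : x ∈ I)
    {a b : B} (h : a * x * b ≠ 0) : Nonempty (I ≃ₗ[B] Ideal.span {a * x * b}) :=
  have := isSimpleModule_iff_isAtom.2 hI
  nonempty_linearEquiv_span_singleton ((LinearMap.toSpanSingleton B B b).comp I.subtype)
    (v := ⟨a * x, I.mul_mem_left a hx⟩) h

theorem isAtom_span_singleton_iff {f : B} :
    IsAtom (Ideal.span {f}) ↔ f ≠ 0 ∧ ∀ z, z * f ≠ 0 → ∃ w, w * (z * f) = f := by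
  rw [isAtom_iff_le_of_ge, Ne, Ideal.span_singleton_eq_bot]
  refine and_congr_right fun _ => ⟨fun h z hz => ?_, fun h J hJ hJf => ?_⟩
  · refine Ideal.mem_span_singleton'.1 ((Ideal.span_singleton_le_iff_mem _).1 (h _ ?_ ?_))
    · rwa [Ne, Ideal.span_singleton_eq_bot]
    · exact (Ideal.span_singleton_le_iff_mem _).2 (Ideal.mem_span_singleton'.2 ⟨z, rfl⟩)
  · obtain ⟨y, hy, hy0⟩ := Submodule.exists_mem_ne_zero_of_ne_bot hJ
    obtain ⟨z, rfl⟩ := Ideal.mem_span_singleton'.1 (hJf hy)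
    obtain ⟨w, hw⟩ := h z hy0
    exact (Ideal.span_singleton_le_iff_mem _).2 (hw ▸ J.mul_mem_left w hy)

theorem isAtom_span_of_corner {k : Type*} [Field k] [Algebra k B]
    (hB : ∀ x : B, x ≠ 0 → ∃ w, x * w * x ≠ 0) {e : B} (he : e ≠ 0)
    (hcorner : ∀ x, ∃ c : k, e * x * e = c • e) : IsAtom (Ideal.span {e}) := by
  refine isAtom_span_singleton_iff.2 ⟨he, fun z hz => ?_⟩
  obtain ⟨w, hw⟩ := hB _ hz
  obtain ⟨c, hc⟩ := hcorner (w * z)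
  have hc0 : c ≠ 0 := by
    rintro rfl
    rw [zero_smul] at hc
    apply hw
    calc z * e * w * (z * e) = z * (e * (w * z) * e) := by simp only [mul_assoc]
      _ = 0 := by rw [hc, mul_zero]
  refine ⟨c⁻¹ • (e * w), ?_⟩
  calc c⁻¹ • (e * w) * (z * e) = c⁻¹ • (e * (w * z) * e) := by
        rw [smul_mul_assoc]; simp only [mul_assoc]
    _ = e := by rw [hc, inv_smul_smul₀ hc0]

end MinimalLeftIdeals

section SpanProducts

variable {R A : Type*} [CommSemiring R] [Semiring A] [Algebra R A]

theorem mul_left_mem_of_mem_span {s : Set A} {M : Submodule R A} {z x : A}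
    (h : ∀ m ∈ s, z * m ∈ M) (hx : x ∈ Submodule.span R s) : z * x ∈ M :=
  (Submodule.span_le (p := M.comap (LinearMap.mulLeft R z))).2 h hx

theorem mul_right_mem_of_mem_span {s : Set A} {M : Submodule R A} {z x : A}
    (h : ∀ m ∈ s, m * z ∈ M) (hx : x ∈ Submodule.span R s) : x * z ∈ M :=
  (Submodule.span_le (p := M.comap (LinearMap.mulRight R z))).2 h hx

end SpanProducts

section Words

variable {𝒜 : Type v} {X : Set (Stream' 𝒜)}

theorem take_append_length (α : List 𝒜) (x : Stream' 𝒜) : (α ++ₛ x).take α.length = α := by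
  rw [Stream'.take_append_of_le_length _ _ _ le_rfl, List.take_length]

theorem mem_language_iff {α : List 𝒜} : α ∈ language X ↔ ∃ x, α ++ₛ x ∈ X := by
  refine ⟨fun ⟨x, hx, h⟩ => ⟨x.drop α.length, ?_⟩, fun ⟨x, hx⟩ => ⟨_, hx, take_append_length α x⟩⟩
  nth_rw 1 [← h]
  rwa [Stream'.append_take_drop]

theorem nil_mem_language {α : List 𝒜} (hα : α ∈ language X) : [] ∈ language X :=
  let ⟨x, hx, _⟩ := hα
  ⟨x, hx, rfl⟩

theorem exists_eq_append_of_append_eq {α β : List 𝒜} {x y : Stream' 𝒜}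
    (h : α ++ₛ x = β ++ₛ y) (hl : α.length ≤ β.length) : ∃ γ, β = α ++ γ ∧ x = γ ++ₛ y := by
  have hβ := List.take_append_drop α.length β
  rw [← hβ, Stream'.append_append_stream] at h
  have hα : α = β.take α.length := Stream'.append_left_injective _ _ _ _ h (by simp [hl])
  rw [← hα] at h hβ
  exact ⟨β.drop α.length, hβ.symm, Stream'.append_right_injective _ _ _ h⟩

theorem eq_of_append_eq_self {γ : List 𝒜} (hγ : γ ≠ []) {y z : Stream' 𝒜}
    (hy : γ ++ₛ y = y) (hz : γ ++ₛ z = z) : y = z := by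
  ext n
  induction n using Nat.strong_induction_on with
  | _ n ih =>
    rw [← hy, ← hz]
    rcases lt_or_ge n γ.length with hn | hn
    · rw [Stream'.get_append_left _ _ _ hn, Stream'.get_append_left _ _ _ hn]
    · obtain ⟨k, rfl⟩ := Nat.exists_eq_add_of_le hn
      rw [Stream'.get_append_right, Stream'.get_append_right]
      exact ih k (by have := List.length_pos_iff.2 hγ; omega)

theorem finite_setOf_append_eq_self {Γ : Set (List 𝒜)} (hΓ : Γ.Finite) (hnil : [] ∉ Γ) :
    {z : Stream' 𝒜 | ∃ γ ∈ Γ, γ ++ₛ z = z}.Finite := by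
  have hsub (γ : List 𝒜) (hγ : γ ∈ Γ) : {z : Stream' 𝒜 | γ ++ₛ z = z}.Finite :=
    Set.Subsingleton.finite fun _ hy _ hz =>
      eq_of_append_eq_self (ne_of_mem_of_not_mem hγ hnil) hy hz
  exact (hΓ.biUnion hsub).subset fun z ⟨γ, hγ, hz⟩ => Set.mem_biUnion hγ hz

/-- A sequence is (purely) periodic if it is of the form `γ^∞`, that is, `x = γx` for a nonempty
word `γ`. -/
def IsPeriodic (x : Stream' 𝒜) : Prop := ∃ γ : List 𝒜, γ ≠ [] ∧ γ ++ₛ x = x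

theorem isPeriodic_cycle (γ : List 𝒜) (hγ : γ ≠ []) : IsPeriodic (Stream'.cycle γ hγ) :=
  ⟨γ, hγ, (Stream'.cycle_eq γ hγ).symm⟩

theorem take_eq_take_of_le {x y : Stream' 𝒜} {k l : ℕ} (hkl : k ≤ l) (h : x.take l = y.take l) :
    x.take k = y.take k := by
  simpa only [Stream'.take_take, min_eq_right hkl] using congrArg (List.take k) h

theorem take_append_congr (γ : List 𝒜) {x y : Stream' 𝒜} {k : ℕ} (h : x.take k = y.take k) :
    (γ ++ₛ x).take k = (γ ++ₛ y).take k := by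
  have take_append (z : Stream' 𝒜) : (γ ++ₛ z).take k = (γ ++ z.take k).take k := by
    rw [Stream'.append_take, Stream'.take_take, min_eq_right (Nat.le_add_left _ _)]
  rw [take_append, take_append, h]

theorem exists_forall_take_ne {s : Set (Stream' 𝒜)} (hs : s.Finite) {y : Stream' 𝒜} (hy : y ∉ s) :
    ∃ k, ∀ z ∈ s, z.take k ≠ y.take k := by
  have hk (z : Stream' 𝒜) : ∃ k, z ∈ s → z.take k ≠ y.take k := by
    by_contra! h
    exact hy (Stream'.take_theorem _ _ (fun n => (h n).2) ▸ (h 0).1)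
  choose k hk using hk
  obtain ⟨K, hK⟩ := (hs.image k).bddAbove
  exact ⟨K, fun z hz h => hk z hz (take_eq_take_of_le (hK (Set.mem_image_of_mem k hz)) h)⟩

end Words

section PartialPreimage

variable {ι κ μ : Type*}

/-- The preimage of a set under a partial injection. -/
def partialPreimage (f : ι ≃. κ) (A : Set κ) : Set ι := {i | ∃ j ∈ A, j ∈ f i}

theorem partialPreimage_refl (A : Set κ) : partialPreimage (PEquiv.refl κ) A = A := by
  ext i
  simp [partialPreimage]

theorem partialPreimage_trans (f : ι ≃. κ) (g : κ ≃. μ) (A : Set μ) :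
    partialPreimage (f.trans g) A = partialPreimage f (partialPreimage g A) := by
  ext i
  constructor
  · rintro ⟨l, hl, h⟩
    obtain ⟨j, hj, hlj⟩ := (PEquiv.mem_trans f g i l).1 h
    exact ⟨j, ⟨l, hl, hlj⟩, hj⟩
  · rintro ⟨j, ⟨l, hl, hlj⟩, hj⟩
    exact ⟨l, hl, (PEquiv.mem_trans f g i l).2 ⟨j, hj, hlj⟩⟩

theorem partialPreimage_compl (f : ι ≃. κ) (A : Set κ) :
    partialPreimage f Aᶜ = partialPreimage f Set.univ \ partialPreimage f A := by
  ext i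
  constructor
  · rintro ⟨j, hj, h⟩
    refine ⟨⟨j, trivial, h⟩, ?_⟩
    rintro ⟨j', hj', h'⟩
    exact hj (Option.mem_unique h h' ▸ hj')
  · rintro ⟨⟨j, -, h⟩, hi⟩
    exact ⟨j, fun hj => hi ⟨j, hj, h⟩, h⟩

theorem partialPreimage_union (f : ι ≃. κ) (A B : Set κ) :
    partialPreimage f (A ∪ B) = partialPreimage f A ∪ partialPreimage f B := by
  ext i
  simp only [partialPreimage, Set.mem_union, Set.mem_ofPred_eq, or_and_right, exists_or]

end PartialPreimage

/-- A set of sequences is shift-invariant if it contains the tail of each of its elements. -/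
class IsShiftInvariant {𝒜 : Type v} (X : Set (Stream' 𝒜)) : Prop where
  tail_mem : ∀ x ∈ X, x.tail ∈ X

section BooleanAlgebra

variable {𝒜 : Type v} {X : Set (Stream' 𝒜)}

theorem mem_of_append_mem [IsShiftInvariant X] {α : List 𝒜} {x : Stream' 𝒜} (h : α ++ₛ x ∈ X) :
    x ∈ X := by
  induction α with
  | nil => exact h
  | cons a α ih => exact ih (IsShiftInvariant.tail_mem _ h)

theorem C_eq_empty {α β : List 𝒜} (h : α ∉ language X ∨ β ∉ language X) : C X α β = ∅ := by
  refine Set.eq_empty_of_forall_notMem ?_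
  rintro y ⟨x, hy, hx⟩
  exact h.elim (· (mem_language_iff.2 ⟨x, hx⟩)) (· (mem_language_iff.2 ⟨x, hy ▸ y.2⟩))

variable (X) in
/-- The set `C(α, β)` as an element of `U X`. Here `α` and `β` may be arbitrary words:
`C(α, β)` is empty unless both belong to the language of `X`. -/
def cylinder (α β : List 𝒜) : U X where
  val := C X α β
  property := by
    by_cases h : α ∈ language X ∧ β ∈ language X
    · exact C_mem_U X h.1 h.2
    · rw [C_eq_empty (not_and_or.1 h)]
      exact BooleanSubalgebra.bot_mem

theorem cylinder_nil_nil : cylinder X [] [] = ⊤ :=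
  Subtype.ext (Set.eq_univ_of_forall fun y => ⟨y, rfl, y.2⟩)

theorem cylinder_eq_bot {α β : List 𝒜} (h : α ∉ language X ∨ β ∉ language X) :
    cylinder X α β = ⊥ :=
  Subtype.ext (C_eq_empty h)

theorem U_induction {motive : U X → Prop} (cylinder : ∀ α β, motive (cylinder X α β))
    (compl : ∀ A, motive A → motive Aᶜ) (sup : ∀ A B, motive A → motive B → motive (A ⊔ B))
    (A : U X) : motive A := by
  have bot : motive ⊥ := by
    rw [← compl_top, ← cylinder_nil_nil]
    exact compl _ (cylinder _ _)
  obtain ⟨A, hA⟩ := A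
  induction hA using BooleanSubalgebra.closure_bot_sup_induction with
  | mem A hA =>
    obtain ⟨α, -, β, -, rfl⟩ := hA
    exact cylinder α β
  | bot => exact bot
  | sup A hA B hB ihA ihB => exact sup ⟨A, hA⟩ ⟨B, hB⟩ ihA ihB
  | compl A hA ih => exact compl ⟨A, hA⟩ ih

theorem mem_cylinder_take [IsShiftInvariant X] {y z : X} {k : ℕ} :
    z ∈ (cylinder X [] ((y : Stream' 𝒜).take k) : Set X) ↔
      (z : Stream' 𝒜).take k = (y : Stream' 𝒜).take k := by
  constructor
  · rintro ⟨x, hx, -⟩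
    simpa only [← hx, Stream'.length_take] using take_append_length ((y : Stream' 𝒜).take k) x
  · intro h
    have hz : (z : Stream' 𝒜) = (y : Stream' 𝒜).take k ++ₛ (z : Stream' 𝒜).drop k := by
      rw [← h, Stream'.append_take_drop]
    exact ⟨_, hz, mem_of_append_mem (hz ▸ z.2)⟩

theorem cylinder_nil_inf_eq_bot {α β : List 𝒜} (hl : α.length ≤ β.length) (h : ¬α <+: β) :
    cylinder X [] α ⊓ cylinder X [] β = ⊥ := by
  refine Subtype.ext (Set.eq_empty_of_forall_notMem ?_)
  rintro y ⟨⟨x, hx, -⟩, x', hx', -⟩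
  obtain ⟨γ, rfl, -⟩ := exists_eq_append_of_append_eq (hx.symm.trans hx') hl
  exact h (List.prefix_append α γ)

theorem exists_coe_eq_singleton [IsShiftInvariant X] {B : U X} (hB : (B : Set X).Finite) {y : X}
    (hy : y ∈ (B : Set X)) : ∃ A : U X, (A : Set X) = {y} := by
  obtain ⟨k, hk⟩ := exists_forall_take_ne (s := Subtype.val '' ((B : Set X) \ {y}))
    (hB.sdiff.image _) (y := y) (by rintro ⟨z, hz, hzy⟩; exact hz.2 (Subtype.ext hzy))
  refine ⟨B ⊓ cylinder X [] ((y : Stream' 𝒜).take k), Set.eq_singleton_iff_unique_mem.2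
    ⟨⟨hy, mem_cylinder_take.2 rfl⟩, fun z hz => ?_⟩⟩
  by_contra hzy
  exact hk z ⟨z, ⟨hz.1, hzy⟩, rfl⟩ (mem_cylinder_take.1 hz.2)

open scoped Classical in
variable (X) in
/-- The partial injection `αx ↦ x` of `X`. -/
noncomputable def stripPrefix (α : List 𝒜) : X ≃. X where
  toFun y := if h : ∃ x : X, (y : Stream' 𝒜) = α ++ₛ (x : Stream' 𝒜) then some h.choose else none
  invFun x := if h : α ++ₛ (x : Stream' 𝒜) ∈ X then some ⟨_, h⟩ else none
  inv y x := by
    simp only [Option.dite_none_right_eq_some, Option.some.injEq]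
    constructor
    · rintro ⟨h, rfl⟩
      have hx : ∃ z : X, α ++ₛ (x : Stream' 𝒜) = α ++ₛ (z : Stream' 𝒜) := ⟨x, rfl⟩
      exact ⟨hx, Subtype.ext (Stream'.append_right_injective _ _ _ hx.choose_spec.symm)⟩
    · rintro ⟨h, rfl⟩
      exact ⟨h.choose_spec ▸ y.2, Subtype.ext h.choose_spec.symm⟩

theorem mem_symm_stripPrefix {α : List 𝒜} {x y : X} :
    y ∈ (stripPrefix X α).symm x ↔ (y : Stream' 𝒜) = α ++ₛ (x : Stream' 𝒜) := by
  refine Option.dite_none_right_eq_some.trans ⟨?_, fun h => ⟨h ▸ y.2, ?_⟩⟩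
  · rintro ⟨h, hy⟩
    rw [← Option.some.inj hy]
  · exact congrArg some (Subtype.ext h.symm)

theorem mem_stripPrefix {α : List 𝒜} {x y : X} :
    x ∈ stripPrefix X α y ↔ (y : Stream' 𝒜) = α ++ₛ (x : Stream' 𝒜) := by
  rw [← PEquiv.mem_iff_mem, mem_symm_stripPrefix]

variable (X) in
theorem stripPrefix_nil : stripPrefix X [] = PEquiv.refl X := by
  refine PEquiv.ext fun y => Option.ext fun x => mem_stripPrefix.trans ?_
  rw [Stream'.nil_append_stream, PEquiv.refl_apply, Option.some_inj, Subtype.ext_iff]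

theorem partialPreimage_mem_U {f : X ≃. X} (hf : ∀ α β, partialPreimage f (C X α β) ∈ U X)
    (A : U X) : partialPreimage f (A : Set X) ∈ U X := by
  induction A using U_induction with
  | cylinder α β => exact hf α β
  | compl A ih =>
    have htop : partialPreimage f Set.univ ∈ U X := by
      have := hf [] []
      rwa [show C X [] [] = Set.univ from congrArg Subtype.val cylinder_nil_nil] at this
    exact partialPreimage_compl f (A : Set X) ▸ BooleanSubalgebra.sdiff_mem htop ih
  | sup A B ihA ihB =>
    exact partialPreimage_union f (A : Set X) B ▸ BooleanSubalgebra.sup_mem ihA ihB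

theorem partialPreimage_symm_stripPrefix_C_cons (a : 𝒜) (γ β : List 𝒜) :
    partialPreimage (stripPrefix X [a]).symm (C X γ (a :: β)) = C X [a] [] ∩ C X γ β := by
  ext y
  simp only [partialPreimage, C, Set.mem_ofPred_eq, mem_symm_stripPrefix, Set.mem_inter_iff]
  constructor
  · rintro ⟨z, ⟨x, hz, hx⟩, hzy⟩
    exact ⟨⟨y, rfl, hzy ▸ z.2⟩, x, Stream'.append_right_injective [a] _ _ (hzy.symm.trans hz), hx⟩
  · rintro ⟨⟨_, rfl, hy⟩, x, hx, hγ⟩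
    exact ⟨⟨_, hy⟩, ⟨x, congrArg ([a] ++ₛ ·) hx, hγ⟩, rfl⟩

theorem partialPreimage_symm_stripPrefix_C_cons_of_ne {a b : 𝒜} (hab : a ≠ b) (γ β : List 𝒜) :
    partialPreimage (stripPrefix X [a]).symm (C X γ (b :: β)) = ∅ := by
  refine Set.eq_empty_of_forall_notMem ?_
  rintro y ⟨z, ⟨x, hz, -⟩, hzy⟩
  rw [mem_symm_stripPrefix, hz] at hzy
  exact hab (congrArg Stream'.head hzy).symm

variable [IsShiftInvariant X]

variable (X) in
theorem stripPrefix_append (α β : List 𝒜) :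
    stripPrefix X (α ++ β) = (stripPrefix X α).trans (stripPrefix X β) := by
  refine PEquiv.ext fun y => Option.ext fun x => ?_
  rw [← Option.mem_def, ← Option.mem_def, PEquiv.mem_trans]
  simp only [mem_stripPrefix, Stream'.append_append_stream]
  constructor
  · intro h
    exact ⟨⟨_, mem_of_append_mem (h ▸ y.2)⟩, h, rfl⟩
  · rintro ⟨z, hz, hx⟩
    rw [hz, hx]

theorem partialPreimage_symm_stripPrefix_C_nil (a : 𝒜) (γ : List 𝒜) :
    partialPreimage (stripPrefix X [a]).symm (C X γ []) = C X (γ ++ [a]) [] := by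
  ext y
  simp only [partialPreimage, C, Set.mem_ofPred_eq, mem_symm_stripPrefix,
    Stream'.append_append_stream]
  constructor
  · rintro ⟨z, ⟨x, hz, hx⟩, hzy⟩
    exact ⟨y, rfl, hzy ▸ hz ▸ hx⟩
  · rintro ⟨x, rfl, hx⟩
    exact ⟨⟨_, mem_of_append_mem hx⟩, ⟨_, rfl, hx⟩, rfl⟩

theorem partialPreimage_symm_stripPrefix_mem_U (α : List 𝒜) (A : U X) :
    partialPreimage (stripPrefix X α).symm (A : Set X) ∈ U X := by
  induction α generalizing A with
  | nil => simpa only [stripPrefix_nil, PEquiv.symm_refl, partialPreimage_refl] using A.2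
  | cons a α ih =>
    rw [← List.singleton_append, stripPrefix_append, PEquiv.symm_trans_rev, partialPreimage_trans]
    refine ih ⟨_, partialPreimage_mem_U (fun γ β => ?_) A⟩
    rcases β with - | ⟨b, β⟩
    · exact partialPreimage_symm_stripPrefix_C_nil (X := X) a γ ▸ (cylinder X _ _).2
    · by_cases hab : a = b
      · subst hab
        exact partialPreimage_symm_stripPrefix_C_cons (X := X) a γ β ▸
          (cylinder X [a] [] ⊓ cylinder X γ β).2
      · exact partialPreimage_symm_stripPrefix_C_cons_of_ne (X := X) hab γ β ▸
          BooleanSubalgebra.bot_mem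

/-- The set `{x ∈ X : αx ∈ A}`. -/
noncomputable def pre (α : List 𝒜) (A : U X) : U X :=
  ⟨partialPreimage (stripPrefix X α).symm A, partialPreimage_symm_stripPrefix_mem_U α A⟩

theorem mem_pre {α : List 𝒜} {A : U X} {x : X} : x ∈ (pre α A : Set X) ↔
    ∃ y ∈ (A : Set X), (y : Stream' 𝒜) = α ++ₛ (x : Stream' 𝒜) := by
  simp only [pre, partialPreimage, Set.mem_ofPred_eq, mem_symm_stripPrefix]

theorem pre_top (α : List 𝒜) : pre α ⊤ = cylinder X α [] :=
  Subtype.ext <| Set.ext fun x => mem_pre.trans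
    ⟨fun ⟨y, _, hy⟩ => ⟨x, rfl, hy ▸ y.2⟩, fun ⟨_, hz, hx⟩ => ⟨⟨_, hx⟩, trivial, hz ▸ rfl⟩⟩

theorem pre_nil (A : U X) : pre [] A = A := by
  refine Subtype.ext (Set.ext fun x => mem_pre.trans ⟨?_, fun hx => ⟨x, hx, rfl⟩⟩)
  rintro ⟨y, hy, hyx⟩
  rwa [← Subtype.ext hyx]

theorem pre_append (α β : List 𝒜) (A : U X) : pre (α ++ β) A = pre β (pre α A) :=
  Subtype.ext <| by
    simp only [pre, stripPrefix_append, PEquiv.symm_trans_rev, partialPreimage_trans]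

theorem pre_compl (α : List 𝒜) (A : U X) : pre α Aᶜ = pre α ⊤ ⊓ (pre α A)ᶜ :=
  Subtype.ext (partialPreimage_compl _ _)

theorem pre_sup (α : List 𝒜) (A B : U X) : pre α (A ⊔ B) = pre α A ⊔ pre α B :=
  Subtype.ext (partialPreimage_union _ _ _)

theorem pre_le_pre_top (α : List 𝒜) (A : U X) : pre α A ≤ pre α ⊤ :=
  fun _ hx => let ⟨y, _, hy⟩ := mem_pre.1 hx; mem_pre.2 ⟨y, trivial, hy⟩

theorem pre_cylinder_nil (a : 𝒜) (γ : List 𝒜) :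
    pre [a] (cylinder X γ []) = cylinder X (γ ++ [a]) [] :=
  Subtype.ext (partialPreimage_symm_stripPrefix_C_nil a γ)

theorem pre_cylinder_cons (a : 𝒜) (γ β : List 𝒜) :
    pre [a] (cylinder X γ (a :: β)) = cylinder X [a] [] ⊓ cylinder X γ β :=
  Subtype.ext (partialPreimage_symm_stripPrefix_C_cons a γ β)

theorem pre_cylinder_cons_of_ne {a b : 𝒜} (hab : a ≠ b) (γ β : List 𝒜) :
    pre [a] (cylinder X γ (b :: β)) = ⊥ :=
  Subtype.ext (partialPreimage_symm_stripPrefix_C_cons_of_ne hab γ β)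

end BooleanAlgebra

/-- A set of sequences has full alphabet if every letter is an initial letter of one of its
elements. -/
class HasFullAlphabet {𝒜 : Type v} (X : Set (Stream' 𝒜)) : Prop where
  letter_mem : ∀ a : 𝒜, [a] ∈ language X

section Relations

variable (R : Type u) [CommRing R] {𝒜 : Type v} (X : Set (Stream' 𝒜))

/-- The element `s_α = s_{α₁} ⋯ s_{αₙ}` of the unital subshift algebra. -/
def sWord (α : List 𝒜) : UnitalSubshiftAlgebra R X :=
  RingQuot.mkAlgHom R (Rel R X) (freeSWord R X α)

/-- The element `s_α^* = s_{αₙ}^* ⋯ s_{α₁}^*` of the unital subshift algebra. -/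
def sStarWord (α : List 𝒜) : UnitalSubshiftAlgebra R X :=
  RingQuot.mkAlgHom R (Rel R X) (freeSStarWord R X α)

local notation "S" => sWord R X
local notation "S⋆" => sStarWord R X
local notation "P" => p R X

theorem sWord_nil : S [] = 1 := by simp [sWord, freeSWord]

theorem sStarWord_nil : S⋆ [] = 1 := by simp [sStarWord, freeSStarWord]

theorem sWord_append (α β : List 𝒜) : S (α ++ β) = S α * S β := by
  simp [sWord, freeSWord]

theorem sStarWord_append (α β : List 𝒜) : S⋆ (α ++ β) = S⋆ β * S⋆ α := by
  simp [sStarWord, freeSStarWord]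

theorem sWord_cons (a : 𝒜) (β : List 𝒜) : S (a :: β) = S [a] * S β := sWord_append R X [a] β

theorem sStarWord_cons (a : 𝒜) (β : List 𝒜) : S⋆ (a :: β) = S⋆ β * S⋆ [a] :=
  sStarWord_append R X [a] β

theorem p_top : P ⊤ = 1 := by
  simpa [p] using RingQuot.mkAlgHom_rel R (Rel.p_top (R := R) (X := X))

theorem p_bot : P ⊥ = 0 := by
  simpa [p] using RingQuot.mkAlgHom_rel R (Rel.p_bot (R := R) (X := X))

theorem p_inf (A B : U X) : P (A ⊓ B) = P A * P B := by
  simpa [p] using RingQuot.mkAlgHom_rel R (Rel.p_inter (R := R) A B)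

theorem p_sup (A B : U X) : P (A ⊔ B) = P A + P B - P A * P B := by
  rw [← p_inf]
  simpa [p] using RingQuot.mkAlgHom_rel R (Rel.p_union (R := R) A B)

theorem p_compl (A : U X) : P Aᶜ = 1 - P A := by
  have h := p_sup R X A Aᶜ
  rw [← p_inf, sup_compl_eq_top, inf_compl_eq_bot, p_top, p_bot, sub_zero] at h
  exact eq_sub_of_add_eq' h.symm

theorem p_commute (A B : U X) : Commute (P A) (P B) := by
  rw [Commute, SemiconjBy, ← p_inf, ← p_inf, inf_comm]

theorem p_mul_self (A : U X) : P A * P A = P A := by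
  rw [← p_inf, inf_idem]

variable {X} in
theorem p_mul_of_le {A B : U X} (h : A ≤ B) : P A * P B = P A := by
  rw [← p_inf, inf_eq_left.2 h]

variable {X} in
theorem sWord_mul_sStarWord_mul_sWord_mul_sStarWord_of_mem {α β : List 𝒜} (hα : α ∈ language X)
    (hβ : β ∈ language X) : S β * S⋆ α * S α * S⋆ β = P (cylinder X α β) := by
  simpa [p, sWord, sStarWord, cylinder] using
    RingQuot.mkAlgHom_rel R (Rel.word (R := R) α β hα hβ)

theorem isGeneralizedInverse_letter (a : 𝒜) : IsGeneralizedInverse (S [a]) (S⋆ [a]) := by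
  constructor
  · simpa [sWord, sStarWord, freeSWord, freeSStarWord] using
      RingQuot.mkAlgHom_rel R (Rel.s_sStar_s (R := R) (X := X) a)
  · simpa [sWord, sStarWord, freeSWord, freeSStarWord] using
      RingQuot.mkAlgHom_rel R (Rel.sStar_s_sStar (R := R) (X := X) a)

section FullAlphabet

variable [HasFullAlphabet X]

theorem sStarWord_mul_sWord_letter (a : 𝒜) : S⋆ [a] * S [a] = P (cylinder X [a] []) := by
  have ha : [a] ∈ language X := HasFullAlphabet.letter_mem a
  simpa only [sWord_nil, sStarWord_nil, one_mul, mul_one] using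
    sWord_mul_sStarWord_mul_sWord_mul_sStarWord_of_mem R ha (nil_mem_language ha)

theorem sWord_mul_sStarWord_and_isGeneralizedInverse (β : List 𝒜) :
    S β * S⋆ β = P (cylinder X [] β) ∧ IsGeneralizedInverse (S β) (S⋆ β) := by
  induction β with
  | nil => simp [IsGeneralizedInverse, sWord_nil, sStarWord_nil, cylinder_nil_nil, p_top]
  | cons a β ih =>
    obtain ⟨hproj, hinv⟩ := ih
    rw [sWord_cons, sStarWord_cons]
    refine ⟨?_, (isGeneralizedInverse_letter R X a).mul hinv ?_⟩
    · by_cases h : a :: β ∈ language X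
      · rw [← sWord_cons, ← sStarWord_cons]
        simpa only [sWord_nil, sStarWord_nil, mul_one] using
          sWord_mul_sStarWord_mul_sWord_mul_sStarWord_of_mem R (nil_mem_language h) h
      · have hbot : cylinder X [a] [] ⊓ cylinder X [] β = ⊥ := by
          refine Subtype.ext (Set.eq_empty_of_forall_notMem ?_)
          rintro y ⟨⟨x, hyx, hx⟩, ⟨z, hyz, -⟩⟩
          obtain rfl : x = β ++ₛ z := hyx.symm.trans hyz
          exact h (mem_language_iff.2 ⟨z, hx⟩)
        calc S [a] * S β * (S⋆ β * S⋆ [a])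
            = S [a] * S⋆ [a] * S [a] * (S β * S⋆ β) * S⋆ [a] := by
              rw [(isGeneralizedInverse_letter R X a).1]; simp only [mul_assoc]
          _ = S [a] * (S⋆ [a] * S [a] * (S β * S⋆ β)) * S⋆ [a] := by simp only [mul_assoc]
          _ = P (cylinder X [] (a :: β)) := by
              rw [sStarWord_mul_sWord_letter, hproj, ← p_inf, hbot, cylinder_eq_bot (.inr h),
                p_bot, mul_zero, zero_mul]
    · rw [sStarWord_mul_sWord_letter, hproj]
      exact p_commute R X _ _

theorem isGeneralizedInverse_word (α : List 𝒜) : IsGeneralizedInverse (S α) (S⋆ α) :=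
  (sWord_mul_sStarWord_and_isGeneralizedInverse R X α).2

theorem sWord_mul_sStarWord (α : List 𝒜) : S α * S⋆ α = P (cylinder X [] α) :=
  (sWord_mul_sStarWord_and_isGeneralizedInverse R X α).1

variable {X} in
theorem sWord_eq_zero {α : List 𝒜} (hα : α ∉ language X) : S α = 0 := by
  rw [← (isGeneralizedInverse_word R X α).1, sWord_mul_sStarWord, cylinder_eq_bot (.inr hα), p_bot,
    zero_mul]

variable {X} in
theorem sStarWord_eq_zero {α : List 𝒜} (hα : α ∉ language X) : S⋆ α = 0 := by
  rw [← (isGeneralizedInverse_word R X α).2, sWord_eq_zero R hα, mul_zero, zero_mul]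

theorem sWord_mul_sStarWord_mul_sWord_mul_sStarWord (α β : List 𝒜) :
    S β * S⋆ α * S α * S⋆ β = P (cylinder X α β) := by
  by_cases hα : α ∈ language X
  · by_cases hβ : β ∈ language X
    · exact sWord_mul_sStarWord_mul_sWord_mul_sStarWord_of_mem R hα hβ
    · rw [cylinder_eq_bot (.inr hβ), p_bot, sStarWord_eq_zero R hβ, mul_zero]
  · rw [cylinder_eq_bot (.inl hα), p_bot, sWord_eq_zero R hα, mul_zero, zero_mul]

theorem sStarWord_mul_sWord (α : List 𝒜) : S⋆ α * S α = P (cylinder X α []) := by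
  simpa only [sWord_nil, sStarWord_nil, one_mul, mul_one] using
    sWord_mul_sStarWord_mul_sWord_mul_sStarWord R X α []

variable {X} in
theorem sStarWord_mul_sWord_eq_zero {α β : List 𝒜} (h : cylinder X [] α ⊓ cylinder X [] β = ⊥) :
    S⋆ α * S β = 0 := by
  rw [← (isGeneralizedInverse_word R X α).2, ← (isGeneralizedInverse_word R X β).1,
    show S⋆ α * S α * S⋆ α * (S β * S⋆ β * S β) = S⋆ α * (S α * S⋆ α * (S β * S⋆ β)) * S β by
      simp only [mul_assoc],
    sWord_mul_sStarWord, sWord_mul_sStarWord, ← p_inf, h, p_bot, mul_zero, zero_mul]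

variable {X} in
theorem sStarWord_mul_p_mul_p_mul_sWord (α : List 𝒜) (A B : U X) :
    S⋆ α * (P A * P B) * S α = S⋆ α * P A * S α * (S⋆ α * P B * S α) := by
  calc S⋆ α * (P A * P B) * S α = S⋆ α * P A * (P B * (S α * S⋆ α)) * S α := by
        nth_rw 1 [← (isGeneralizedInverse_word R X α).1]; simp only [mul_assoc]
    _ = S⋆ α * P A * (S α * S⋆ α * P B) * S α := by
        rw [sWord_mul_sStarWord, (p_commute R X _ _).eq]
    _ = S⋆ α * P A * S α * (S⋆ α * P B * S α) := by simp only [mul_assoc]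

end FullAlphabet

variable [IsShiftInvariant X] [HasFullAlphabet X]

theorem sStarWord_mul_p_cylinder_mul_sWord_letter (a : 𝒜) (γ β : List 𝒜) :
    S⋆ [a] * P (cylinder X γ β) * S [a] = P (pre [a] (cylinder X γ β)) := by
  rw [← sWord_mul_sStarWord_mul_sWord_mul_sStarWord]
  rcases β with - | ⟨b, β⟩
  · rw [sWord_nil, sStarWord_nil, one_mul, mul_one, pre_cylinder_nil, ← sStarWord_mul_sWord,
      sWord_append, sStarWord_append]
    simp only [mul_assoc]
  rcases eq_or_ne a b with rfl | hab
  · calc S⋆ [a] * (S (a :: β) * S⋆ γ * S γ * S⋆ (a :: β)) * S [a]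
        = S⋆ [a] * S [a] * (S β * S⋆ γ * S γ * S⋆ β) * (S⋆ [a] * S [a]) := by
          rw [sWord_cons R X a β, sStarWord_cons R X a β]; simp only [mul_assoc]
      _ = P (pre [a] (cylinder X γ (a :: β))) := by
          rw [sWord_mul_sStarWord_mul_sWord_mul_sStarWord, sStarWord_mul_sWord, pre_cylinder_cons,
            ← p_inf, ← p_inf, inf_right_comm, inf_idem]
  · have hbot : cylinder X [] [a] ⊓ cylinder X [] (b :: β) = ⊥ :=
      cylinder_nil_inf_eq_bot (by simp) (by simp [hab])
    rw [pre_cylinder_cons_of_ne hab, p_bot, ← mul_assoc, ← mul_assoc, ← mul_assoc,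
      sStarWord_mul_sWord_eq_zero R hbot, zero_mul, zero_mul, zero_mul, zero_mul]

theorem sStarWord_mul_p_mul_sWord_letter (a : 𝒜) (A : U X) :
    S⋆ [a] * P A * S [a] = P (pre [a] A) := by
  induction A using U_induction with
  | cylinder γ β => exact sStarWord_mul_p_cylinder_mul_sWord_letter R X a γ β
  | compl A ih =>
    rw [pre_compl, p_inf, p_compl, p_compl, mul_sub, sub_mul, mul_one, ih, mul_sub, mul_one,
      sStarWord_mul_sWord, pre_top, (p_commute R X _ _).eq, p_mul_of_le R]
    exact pre_top (X := X) [a] ▸ pre_le_pre_top [a] A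
  | sup A B ihA ihB =>
    rw [pre_sup, p_sup, p_sup, mul_sub, mul_add, sub_mul, add_mul, sStarWord_mul_p_mul_p_mul_sWord,
      ihA, ihB]

theorem sStarWord_mul_p_mul_sWord (α : List 𝒜) (A : U X) :
    S⋆ α * P A * S α = P (pre α A) := by
  induction α generalizing A with
  | nil => rw [sWord_nil, sStarWord_nil, one_mul, mul_one, pre_nil]
  | cons a α ih =>
    rw [← List.singleton_append, pre_append, ← ih, ← sStarWord_mul_p_mul_sWord_letter,
      sWord_append, sStarWord_append]
    simp only [mul_assoc]

theorem p_mul_sWord (α : List 𝒜) (A : U X) : P A * S α = S α * P (pre α A) := by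
  rw [← sStarWord_mul_p_mul_sWord, ← mul_assoc, ← mul_assoc, sWord_mul_sStarWord,
    (p_commute R X _ _).eq, mul_assoc, ← sWord_mul_sStarWord, (isGeneralizedInverse_word R X α).1]

theorem sStarWord_mul_p (α : List 𝒜) (A : U X) : S⋆ α * P A = P (pre α A) * S⋆ α := by
  rw [← sStarWord_mul_p_mul_sWord, mul_assoc, sWord_mul_sStarWord, mul_assoc,
    (p_commute R X _ _).eq, ← sWord_mul_sStarWord, ← mul_assoc, ← mul_assoc,
    (isGeneralizedInverse_word R X α).2]

theorem sStarWord_mul_sWord_append (α γ : List 𝒜) :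
    S⋆ α * S (α ++ γ) = S γ * P (pre γ (pre α ⊤)) := by
  rw [sWord_append, ← mul_assoc, sStarWord_mul_sWord, p_mul_sWord, pre_top]

end Relations

section Monomials

variable (R : Type u) [CommRing R] {𝒜 : Type v} (X : Set (Stream' 𝒜))

local notation "S" => sWord R X
local notation "S⋆" => sStarWord R X
local notation "P" => p R X

/-- The span of the monomials `s_α p_A s_β^*` with `α ∈ K` and `β ∈ L`. Thus
`monomialSpan R X {[]} {[]}` is the diagonal subalgebra, spanned by the `p_A`. -/
def monomialSpan (K L : Set (List 𝒜)) : Submodule R (UnitalSubshiftAlgebra R X) :=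
  Submodule.span R {m | ∃ α ∈ K, ∃ A, ∃ β ∈ L, m = S α * P A * S⋆ β}

section

variable {X} {K L : Set (List 𝒜)} {x : UnitalSubshiftAlgebra R X}

theorem monomial_mem {α β : List 𝒜} (hα : α ∈ K) (A : U X) (hβ : β ∈ L) :
    S α * P A * S⋆ β ∈ monomialSpan R X K L :=
  Submodule.subset_span ⟨α, hα, A, β, hβ, rfl⟩

theorem sWord_mul_p_mem {α : List 𝒜} (hα : α ∈ K) (A : U X) :
    S α * P A ∈ monomialSpan R X K {[]} := by
  simpa only [sStarWord_nil, mul_one] using monomial_mem R hα A (Set.mem_singleton [])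

theorem p_mem (A : U X) : P A ∈ monomialSpan R X {[]} {[]} := by
  simpa only [sWord_nil, one_mul] using sWord_mul_p_mem R (Set.mem_singleton []) A

variable {R}

theorem monomialSpan_mono {K' L' : Set (List 𝒜)} (hK : K ⊆ K') (hL : L ⊆ L') :
    monomialSpan R X K L ≤ monomialSpan R X K' L' :=
  Submodule.span_mono fun _ ⟨α, hα, A, β, hβ, h⟩ => ⟨α, hK hα, A, β, hL hβ, h⟩

theorem exists_finset_mem_monomialSpan (hx : x ∈ monomialSpan R X K L) :
    ∃ K' L' : Finset (List 𝒜), ↑K' ⊆ K ∧ ↑L' ⊆ L ∧ x ∈ monomialSpan R X K' L' := by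
  classical
  induction hx using Submodule.span_induction with
  | mem m hm =>
    obtain ⟨α, hα, A, β, hβ, rfl⟩ := hm
    exact ⟨{α}, {β}, by simpa, by simpa, monomial_mem R (by simp) A (by simp)⟩
  | zero => exact ⟨∅, ∅, by simp, by simp, zero_mem _⟩
  | add x y _ _ hx hy =>
    obtain ⟨K₁, L₁, hK₁, hL₁, hx⟩ := hx
    obtain ⟨K₂, L₂, hK₂, hL₂, hy⟩ := hy
    refine ⟨K₁ ∪ K₂, L₁ ∪ L₂, by simp [*], by simp [*], add_mem ?_ ?_⟩
    · exact monomialSpan_mono (by simp) (by simp) hx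
    · exact monomialSpan_mono (by simp) (by simp) hy
  | smul c x _ hx =>
    obtain ⟨K', L', hK', hL', hx⟩ := hx
    exact ⟨K', L', hK', hL', Submodule.smul_mem _ c hx⟩

theorem exists_of_mem_monomialSpan_insert_left {α : List 𝒜}
    (hx : x ∈ monomialSpan R X (insert α K) L) :
    ∃ d ∈ monomialSpan R X {[]} L, ∃ y ∈ monomialSpan R X K L, x = S α * d + y := by
  have hle : monomialSpan R X (insert α K) L ≤
      (monomialSpan R X {[]} L).map (LinearMap.mulLeft R (S α)) ⊔ monomialSpan R X K L := by
    refine Submodule.span_le.2 ?_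
    rintro _ ⟨α', rfl | hα', A, β, hβ, rfl⟩
    · refine Submodule.mem_sup_left ⟨_, monomial_mem R (Set.mem_singleton []) A hβ, ?_⟩
      rw [LinearMap.mulLeft_apply, sWord_nil, one_mul, mul_assoc]
    · exact Submodule.mem_sup_right (monomial_mem R hα' A hβ)
  obtain ⟨_, ⟨d, hd, rfl⟩, y, hy, rfl⟩ := Submodule.mem_sup.1 (hle hx)
  exact ⟨d, hd, y, hy, rfl⟩

theorem exists_of_mem_monomialSpan_insert_right {β : List 𝒜}
    (hx : x ∈ monomialSpan R X K (insert β L)) :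
    ∃ d ∈ monomialSpan R X K {[]}, ∃ y ∈ monomialSpan R X K L, x = d * S⋆ β + y := by
  have hle : monomialSpan R X K (insert β L) ≤
      (monomialSpan R X K {[]}).map (LinearMap.mulRight R (S⋆ β)) ⊔ monomialSpan R X K L := by
    refine Submodule.span_le.2 ?_
    rintro _ ⟨α, hα, A, β', rfl | hβ', rfl⟩
    · exact Submodule.mem_sup_left ⟨_, sWord_mul_p_mem R hα A, rfl⟩
    · exact Submodule.mem_sup_right (monomial_mem R hα A hβ')
  obtain ⟨_, ⟨d, hd, rfl⟩, y, hy, rfl⟩ := Submodule.mem_sup.1 (hle hx)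
  exact ⟨d, hd, y, hy, rfl⟩

end

variable [IsShiftInvariant X] [HasFullAlphabet X]

theorem sStarWord_letter_mul_monomial_mem (a : 𝒜) (α : List 𝒜) (A : U X) (β : List 𝒜) :
    S⋆ [a] * (S α * P A * S⋆ β) ∈ monomialSpan R X .univ .univ := by
  rcases α with - | ⟨b, α⟩
  · rw [sWord_nil, one_mul, ← mul_assoc, sStarWord_mul_p, mul_assoc, ← sStarWord_append]
    simpa only [sWord_nil, one_mul] using monomial_mem R (Set.mem_univ []) _ (Set.mem_univ _)
  rcases eq_or_ne a b with rfl | hab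
  · rw [← mul_assoc, ← mul_assoc, ← List.singleton_append (l := α), sStarWord_mul_sWord_append,
      mul_assoc (S α), ← p_inf]
    exact monomial_mem R (Set.mem_univ _) _ (Set.mem_univ _)
  · rw [← mul_assoc, ← mul_assoc, sStarWord_mul_sWord_eq_zero R
      (cylinder_nil_inf_eq_bot (by simp) (by simp [hab])), zero_mul, zero_mul]
    exact zero_mem _

theorem generator_mul_monomial_mem (g : Generator X) (α : List 𝒜) (A : U X) (β : List 𝒜) :
    RingQuot.mkAlgHom R (Rel R X) (FreeAlgebra.ι R g) * (S α * P A * S⋆ β) ∈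
      monomialSpan R X .univ .univ := by
  cases g with
  | p B =>
    change P B * _ ∈ _
    rw [← mul_assoc, ← mul_assoc, p_mul_sWord, mul_assoc (S α), ← p_inf]
    exact monomial_mem R (Set.mem_univ _) _ (Set.mem_univ _)
  | s a =>
    have hs : RingQuot.mkAlgHom R (Rel R X) (FreeAlgebra.ι R (Generator.s a)) = S [a] := by
      simp [sWord, freeSWord, freeS]
    rw [hs, ← mul_assoc, ← mul_assoc, ← sWord_append]
    exact monomial_mem R (Set.mem_univ _) _ (Set.mem_univ _)
  | sStar a =>
    have hs : RingQuot.mkAlgHom R (Rel R X) (FreeAlgebra.ι R (Generator.sStar a)) = S⋆ [a] := by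
      simp [sStarWord, freeSStarWord, freeSStar]
    rw [hs]
    exact sStarWord_letter_mul_monomial_mem R X a α A β

theorem monomialSpan_univ_univ : monomialSpan R X .univ .univ = ⊤ := by
  set M := monomialSpan R X .univ .univ
  have mul_mem (f : FreeAlgebra R (Generator X)) :
      ∀ m ∈ M, RingQuot.mkAlgHom R (Rel R X) f * m ∈ M := by
    induction f using FreeAlgebra.induction with
    | grade0 r =>
      intro m hm
      rw [AlgHom.commutes, ← Algebra.smul_def]
      exact M.smul_mem r hm
    | grade1 g =>
      refine fun m hm => mul_left_mem_of_mem_span ?_ hm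
      rintro _ ⟨α, -, A, β, -, rfl⟩
      exact generator_mul_monomial_mem R X g α A β
    | mul f g hf hg =>
      intro m hm
      rw [map_mul, mul_assoc]
      exact hf _ (hg _ hm)
    | add f g hf hg =>
      intro m hm
      rw [map_add, add_mul]
      exact M.add_mem (hf _ hm) (hg _ hm)
  have one_mem : (1 : UnitalSubshiftAlgebra R X) ∈ M := by
    simpa only [p_top] using monomialSpan_mono (Set.subset_univ _) (Set.subset_univ _) (p_mem R ⊤)
  refine eq_top_iff.2 fun x _ => ?_
  obtain ⟨f, rfl⟩ := RingQuot.mkAlgHom_surjective R (Rel R X) x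
  simpa only [mul_one] using mul_mem f 1 one_mem

end Monomials

section WeightedPull

variable {ι κ μ Λ : Type*} [CommSemiring Λ]

/-- Pulling back functions along a partial injection `f` and multiplying by the weight `w`; the
result is zero outside of the domain of `f`. -/
def weightedPull (f : ι ≃. κ) (w : Λ) : (κ → Λ) →ₗ[Λ] (ι → Λ) where
  toFun g i := (f i).elim 0 fun j => w * g j
  map_add' g h := by
    ext i
    cases hi : f i <;> simp [hi, mul_add]
  map_smul' c g := by
    ext i
    cases hi : f i <;> simp [hi, mul_left_comm]

theorem weightedPull_apply (f : ι ≃. κ) (w : Λ) (g : κ → Λ) (i : ι) :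
    weightedPull f w g i = (f i).elim 0 fun j => w * g j :=
  rfl

theorem weightedPull_apply_of_mem {f : ι ≃. κ} {i : ι} {j : κ} (h : j ∈ f i) (w : Λ) (g : κ → Λ) :
    weightedPull f w g i = w * g j := by
  rw [weightedPull_apply, Option.mem_def.1 h, Option.elim_some]

theorem weightedPull_refl : weightedPull (PEquiv.refl ι) (1 : Λ) = LinearMap.id :=
  LinearMap.ext fun g => funext fun _ => one_mul (g _)

theorem weightedPull_trans (f : ι ≃. κ) (g : κ ≃. μ) (w w' : Λ) :
    weightedPull (f.trans g) (w * w') = weightedPull f w ∘ₗ weightedPull g w' := by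
  refine LinearMap.ext fun h => funext fun i => ?_
  cases hi : f i with
  | none => simp [weightedPull_apply, PEquiv.trans, hi]
  | some j => cases hj : g j <;> simp [weightedPull_apply, PEquiv.trans, hi, hj, mul_assoc]

open scoped Classical in
theorem weightedPull_ofSet (A : Set ι) (g : ι → Λ) :
    weightedPull (PEquiv.ofSet A) 1 g = A.indicator g := by
  ext i
  by_cases hi : i ∈ A
  · rw [weightedPull_apply_of_mem (PEquiv.mem_ofSet_self_iff.2 hi), one_mul,
      Set.indicator_of_mem hi]
  · simp [weightedPull_apply, PEquiv.ofSet, hi]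

theorem trans_symm_trans_self (f : ι ≃. κ) : (f.trans f.symm).trans f = f := by
  refine PEquiv.ext fun i => Option.ext fun j => ?_
  simp only [← Option.mem_def, PEquiv.mem_trans, PEquiv.mem_iff_mem]
  exact ⟨fun ⟨j', ⟨i', hi, hi'⟩, hj⟩ => PEquiv.inj f hi hi' ▸ hj, fun hj => ⟨i, ⟨j, hj, hj⟩, hj⟩⟩

end WeightedPull

section Representation

open LaurentPolynomial

variable (R : Type u) [CommRing R] {𝒜 : Type v} (X : Set (Stream' 𝒜))

open Classical in
/-- The images of the generators in the regular representation of the unital subshift algebra on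
the functions on `X`. The variable `T` records the grading in which `s_a` has degree `1` and `s_a^*`
has degree `-1`. -/
noncomputable def repGenerator : Generator X → Module.End R[T;T⁻¹] (X → R[T;T⁻¹])
  | .p A => weightedPull (PEquiv.ofSet (A : Set X)) 1
  | .s a => weightedPull (stripPrefix X [a]) (T 1)
  | .sStar a => weightedPull (stripPrefix X [a]).symm (T (-1))

open Classical in
theorem lift_freeP (A : U X) : FreeAlgebra.lift R (repGenerator R X) (freeP R X A) =
    weightedPull (PEquiv.ofSet (A : Set X)) 1 := by
  rw [freeP, FreeAlgebra.lift_ι_apply, repGenerator]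

theorem lift_freeS (a : 𝒜) : FreeAlgebra.lift R (repGenerator R X) (freeS R X a) =
    weightedPull (stripPrefix X [a]) (T 1) := by
  rw [freeS, FreeAlgebra.lift_ι_apply, repGenerator]

theorem lift_freeSStar (a : 𝒜) : FreeAlgebra.lift R (repGenerator R X) (freeSStar R X a) =
    weightedPull (stripPrefix X [a]).symm (T (-1)) := by
  rw [freeSStar, FreeAlgebra.lift_ι_apply, repGenerator]

variable [IsShiftInvariant X]

theorem lift_freeSWord (α : List 𝒜) : FreeAlgebra.lift R (repGenerator R X) (freeSWord R X α) =
    weightedPull (stripPrefix X α) (T α.length) := by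
  induction α with
  | nil => simp [freeSWord, stripPrefix_nil, weightedPull_refl, Module.End.one_eq_id]
  | cons a α ih =>
    have hcons : freeSWord R X (a :: α) = freeS R X a * freeSWord R X α := by simp [freeSWord]
    rw [hcons, map_mul, ih, lift_freeS, Module.End.mul_eq_comp, ← weightedPull_trans,
      ← stripPrefix_append, List.singleton_append, ← T_add, List.length_cons, Nat.cast_succ,
      add_comm]

theorem lift_freeSStarWord (α : List 𝒜) :
    FreeAlgebra.lift R (repGenerator R X) (freeSStarWord R X α) =
      weightedPull (stripPrefix X α).symm (T (-α.length)) := by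
  induction α with
  | nil => simp [freeSStarWord, stripPrefix_nil, weightedPull_refl, Module.End.one_eq_id]
  | cons a α ih =>
    have hcons : freeSStarWord R X (a :: α) = freeSStarWord R X α * freeSStar R X a := by
      simp [freeSStarWord]
    rw [hcons, map_mul, ih, lift_freeSStar, Module.End.mul_eq_comp, ← weightedPull_trans,
      ← PEquiv.symm_trans_rev, ← stripPrefix_append, List.singleton_append, ← T_add,
      List.length_cons, Nat.cast_succ, neg_add]

open Classical in
theorem stripPrefix_trans_eq_ofSet_C (α β : List 𝒜) :
    (((stripPrefix X β).trans (stripPrefix X α).symm).trans (stripPrefix X α)).trans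
      (stripPrefix X β).symm = PEquiv.ofSet (C X α β) := by
  refine PEquiv.ext fun y => Option.ext fun z => ?_
  simp only [← Option.mem_def, PEquiv.mem_trans, mem_stripPrefix, mem_symm_stripPrefix,
    PEquiv.mem_ofSet_iff]
  constructor
  · rintro ⟨x', ⟨w, ⟨x, hy, hw⟩, hw'⟩, hz⟩
    have hx : (x : Stream' 𝒜) = x' := Stream'.append_right_injective _ _ _ (hw.symm.trans hw')
    exact ⟨Subtype.ext (hz.trans (hx ▸ hy.symm)), x, hz.trans (hx ▸ rfl), hw ▸ w.2⟩
  · rintro ⟨rfl, x, hz, hx⟩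
    exact ⟨⟨x, mem_of_append_mem hx⟩, ⟨⟨_, hx⟩, ⟨⟨x, mem_of_append_mem hx⟩, hz, rfl⟩, rfl⟩, hz⟩

theorem lift_eq_of_rel {x y : FreeAlgebra R (Generator X)} (h : Rel R X x y) :
    FreeAlgebra.lift R (repGenerator R X) x = FreeAlgebra.lift R (repGenerator R X) y := by
  cases h with
  | p_top =>
    rw [lift_freeP, map_one]
    exact LinearMap.ext fun f => (weightedPull_ofSet _ f).trans (Set.indicator_univ f)
  | p_inter A B =>
    rw [map_mul, lift_freeP, lift_freeP, lift_freeP]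
    refine LinearMap.ext fun f => ?_
    simp only [Module.End.mul_apply, weightedPull_ofSet]
    exact (Set.indicator_indicator (A : Set X) B f).symm
  | p_union A B =>
    rw [map_sub, map_add, lift_freeP, lift_freeP, lift_freeP, lift_freeP, eq_sub_iff_add_eq]
    refine LinearMap.ext fun f => ?_
    simp only [LinearMap.add_apply, weightedPull_ofSet]
    exact Set.indicator_union_add_inter f (A : Set X) B
  | p_bot =>
    rw [lift_freeP, map_zero]
    exact LinearMap.ext fun f => (weightedPull_ofSet _ f).trans (Set.indicator_empty f)
  | s_sStar_s a =>
    simp only [map_mul, lift_freeS, lift_freeSStar, Module.End.mul_eq_comp, ← weightedPull_trans,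
      trans_symm_trans_self, ← T_add, add_neg_cancel, zero_add]
  | sStar_s_sStar a =>
    have htrans := trans_symm_trans_self (stripPrefix X [a]).symm
    rw [PEquiv.symm_symm] at htrans
    simp only [map_mul, lift_freeS, lift_freeSStar, Module.End.mul_eq_comp, ← weightedPull_trans,
      htrans, ← T_add, neg_add_cancel, zero_add]
  | word α β hα hβ =>
    simp only [map_mul, lift_freeP, lift_freeSWord, lift_freeSStarWord, Module.End.mul_eq_comp,
      ← weightedPull_trans, stripPrefix_trans_eq_ofSet_C, ← T_add, neg_add_cancel_right,
      add_neg_cancel, T_zero]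

/-- The graded regular representation of the unital subshift algebra on the functions on `X`. -/
noncomputable def rep : UnitalSubshiftAlgebra R X →ₐ[R] Module.End R[T;T⁻¹] (X → R[T;T⁻¹]) :=
  RingQuot.liftAlgHom R ⟨FreeAlgebra.lift R (repGenerator R X), fun _ _ h => lift_eq_of_rel R X h⟩

open Classical in
theorem rep_p (A : U X) : rep R X (p R X A) = weightedPull (PEquiv.ofSet (A : Set X)) 1 := by
  rw [rep, p, RingQuot.liftAlgHom_mkAlgHom_apply, lift_freeP]

theorem rep_sWord (α : List 𝒜) :
    rep R X (sWord R X α) = weightedPull (stripPrefix X α) (T α.length) := by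
  rw [rep, sWord, RingQuot.liftAlgHom_mkAlgHom_apply, lift_freeSWord]

open Classical in
/-- The diagonal matrix coefficient at `y` of the graded regular representation. -/
noncomputable def coeffAt (y : X) : UnitalSubshiftAlgebra R X →ₗ[R] R[T;T⁻¹] where
  toFun a := rep R X a (Pi.single y 1) y
  map_add' a b := by simp
  map_smul' c a := by simp

variable {X}

open Classical in
theorem coeffAt_apply (y : X) (a : UnitalSubshiftAlgebra R X) :
    coeffAt R X y a = rep R X a (Pi.single y 1) y :=
  rfl

theorem coeffAt_p {y : X} {A : U X} (h : y ∈ (A : Set X)) : coeffAt R X y (p R X A) = 1 := by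
  classical
  rw [coeffAt_apply, rep_p, weightedPull_ofSet, Set.indicator_of_mem h, Pi.single_eq_same]

theorem coeffAt_one (y : X) : coeffAt R X y 1 = 1 := by
  rw [← p_top, coeffAt_p R (Set.mem_univ y)]

theorem p_ne_zero [Nontrivial R] {y : X} {A : U X} (h : y ∈ (A : Set X)) : p R X A ≠ 0 := by
  intro h0
  have hcoeff := coeffAt_p R h
  rw [h0, map_zero] at hcoeff
  exact zero_ne_one hcoeff

open Classical in
theorem coeffAt_sWord_mul_p (y : X) (γ : List 𝒜) (A : U X) :
    coeffAt R X y (sWord R X γ * p R X A) =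
      if γ ++ₛ (y : Stream' 𝒜) = y ∧ y ∈ (A : Set X) then T γ.length else 0 := by
  rw [coeffAt_apply, map_mul, Module.End.mul_apply, rep_sWord, rep_p, weightedPull_ofSet]
  cases h : stripPrefix X γ y with
  | none =>
    have hy : γ ++ₛ (y : Stream' 𝒜) ≠ y := fun hy => by
      simpa [h] using mem_stripPrefix.2 hy.symm
    rw [weightedPull_apply, h, Option.elim_none, if_neg fun hyA => hy hyA.1]
  | some x =>
    have hy := mem_stripPrefix.1 h
    rw [weightedPull_apply, h, Option.elim_some]
    by_cases hxy : x = y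
    · subst hxy
      by_cases hA : x ∈ (A : Set X) <;> simp [hA, ← hy]
    · have hγ : γ ++ₛ (y : Stream' 𝒜) ≠ y := fun hγ =>
        hxy (Subtype.ext (Stream'.append_right_injective γ _ _ (hy.symm.trans hγ.symm)))
      rw [if_neg fun hyA => hγ hyA.1, Set.indicator_apply, Pi.single_eq_of_ne hxy, ite_self,
        mul_zero]

theorem coeffAt_mul_p_mul {y : X} {A : U X} (h : (A : Set X) = {y})
    (a b : UnitalSubshiftAlgebra R X) :
    coeffAt R X y (a * p R X A * b) = coeffAt R X y a * coeffAt R X y b := by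
  classical
  have hA (f : X → R[T;T⁻¹]) : rep R X (p R X A) f = f y • Pi.single y 1 := by
    rw [rep_p, weightedPull_ofSet, h, Set.indicator_singleton, ← Pi.single_smul', smul_eq_mul,
      mul_one]
  rw [coeffAt_apply, map_mul, map_mul, Module.End.mul_apply, Module.End.mul_apply, hA, map_smul,
    Pi.smul_apply, smul_eq_mul, mul_comm]
  rfl

theorem coeffAt_p_mul {y : X} {A : U X} (h : (A : Set X) = {y}) (a : UnitalSubshiftAlgebra R X) :
    coeffAt R X y (p R X A * a) = coeffAt R X y a := by
  rw [← one_mul (p R X A), coeffAt_mul_p_mul R h, coeffAt_one, one_mul]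

theorem coeffAt_sWord {y : X} {γ : List 𝒜} (h : γ ++ₛ (y : Stream' 𝒜) = y) :
    coeffAt R X y (sWord R X γ) = T γ.length := by
  rw [← mul_one (sWord R X γ), ← p_top, coeffAt_sWord_mul_p, if_pos ⟨h, Set.mem_univ y⟩]

end Representation

section Reduction

variable {R : Type u} [CommRing R] {𝒜 : Type v} {X : Set (Stream' 𝒜)}

local notation "S" => sWord R X
local notation "S⋆" => sStarWord R X
local notation "P" => p R X

theorem p_eq_p_inf_add_p_inf_compl (A B : U X) : P B = P (B ⊓ A) + P (B ⊓ Aᶜ) := by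
  rw [p_inf, p_inf, p_compl, mul_sub, mul_one, add_sub_cancel]

/-- Elements of the diagonal are locally constant functions. -/
theorem exists_mul_p_eq_smul {d : UnitalSubshiftAlgebra R X} (hd : d ∈ monomialSpan R X {[]} {[]})
    {z : UnitalSubshiftAlgebra R X} {B : U X} (hz : z * P B ≠ 0) :
    ∃ B' ≤ B, z * P B' ≠ 0 ∧ ∃ e : R, d * P B' = e • P B' := by
  induction hd using Submodule.span_induction generalizing B with
  | mem d hd =>
    obtain ⟨_, rfl, A, _, rfl, rfl⟩ := hd
    rw [sWord_nil, sStarWord_nil, one_mul, mul_one]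
    by_cases hA : z * P (B ⊓ A) = 0
    · refine ⟨B ⊓ Aᶜ, inf_le_left, ?_, 0, ?_⟩
      · rwa [p_eq_p_inf_add_p_inf_compl A, mul_add, hA, zero_add] at hz
      · rw [← p_inf, inf_left_comm, inf_compl_eq_bot, inf_bot_eq, p_bot, zero_smul]
    · refine ⟨B ⊓ A, inf_le_left, hA, 1, ?_⟩
      rw [← p_inf, inf_left_comm, inf_idem, one_smul]
  | zero => exact ⟨B, le_rfl, hz, 0, by rw [zero_mul, zero_smul]⟩
  | add d d' _ _ ih ih' =>
    obtain ⟨B₁, hB₁, hz₁, e, he⟩ := ih hz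
    obtain ⟨B₂, hB₂, hz₂, e', he'⟩ := ih' hz₁
    refine ⟨B₂, hB₂.trans hB₁, hz₂, e + e', ?_⟩
    have hP : P B₁ * P B₂ = P B₂ := (p_commute R X _ _).eq.trans (p_mul_of_le R hB₂)
    rw [add_mul, he', add_smul, ← hP, ← mul_assoc, he, smul_mul_assoc, hP]
  | smul c d _ ih =>
    obtain ⟨B', hB', hz', e, he⟩ := ih hz
    exact ⟨B', hB', hz', c * e, by rw [smul_mul_assoc, he, mul_smul]⟩

variable [IsShiftInvariant X]

theorem pre_inf_self_eq_bot {γ : List 𝒜} {D : U X} {k : ℕ} {y : Stream' 𝒜}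
    (hD : ∀ z ∈ (D : Set X), (z : Stream' 𝒜).take k = y.take k)
    (hy : (γ ++ₛ y).take k ≠ y.take k) : pre γ D ⊓ D = ⊥ := by
  refine Subtype.ext (Set.eq_empty_of_forall_notMem ?_)
  rintro w ⟨hw, hwD⟩
  obtain ⟨z, hz, hzw⟩ := mem_pre.1 hw
  exact hy (by rw [← take_append_congr γ (hD w hwD), ← hzw, hD z hz])

open LaurentPolynomial in
theorem coeff_zero_coeffAt (y : X) {n : UnitalSubshiftAlgebra R X}
    (hn : n ∈ monomialSpan R X {[]}ᶜ {[]}) : (coeffAt R X y n).coeff 0 = 0 := by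
  induction hn using Submodule.span_induction with
  | mem n hn =>
    obtain ⟨γ, hγ, A, _, rfl, rfl⟩ := hn
    rw [sStarWord_nil, mul_one, coeffAt_sWord_mul_p]
    split_ifs
    · have hlen := List.length_pos_iff.2 hγ
      rw [T_apply, if_neg (by omega)]
    · rfl
  | zero => simp
  | add a b _ _ ha hb => simp [ha, hb]
  | smul c a _ ha => simp [ha]

variable [HasFullAlphabet X] {K L : Set (List 𝒜)} {x : UnitalSubshiftAlgebra R X}

theorem p_mul_mem (A : U X) (hx : x ∈ monomialSpan R X K L) : P A * x ∈ monomialSpan R X K L := by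
  refine mul_left_mem_of_mem_span ?_ hx
  rintro _ ⟨α, hα, B, β, hβ, rfl⟩
  rw [← mul_assoc, ← mul_assoc, p_mul_sWord, mul_assoc (S α), ← p_inf]
  exact monomial_mem R hα _ hβ

theorem mul_p_mem (A : U X) (hx : x ∈ monomialSpan R X K L) : x * P A ∈ monomialSpan R X K L := by
  refine mul_right_mem_of_mem_span ?_ hx
  rintro _ ⟨α, hα, B, β, hβ, rfl⟩
  rw [mul_assoc, sStarWord_mul_p, ← mul_assoc, mul_assoc (S α), ← p_inf]
  exact monomial_mem R hα _ hβ

theorem mul_sWord_mem {β : List 𝒜} (hβ : ∀ β' ∈ L, β'.length ≤ β.length)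
    (hx : x ∈ monomialSpan R X .univ L) : x * S β ∈ monomialSpan R X .univ {[]} := by
  refine mul_right_mem_of_mem_span ?_ hx
  rintro _ ⟨α, -, A, β', hβ', rfl⟩
  by_cases hpre : β' <+: β
  · obtain ⟨γ, rfl⟩ := hpre
    rw [mul_assoc, sStarWord_mul_sWord_append, ← mul_assoc, mul_assoc (S α), p_mul_sWord,
      ← mul_assoc, ← sWord_append, mul_assoc, ← p_inf]
    exact sWord_mul_p_mem R (Set.mem_univ _) _
  · rw [mul_assoc, sStarWord_mul_sWord_eq_zero R (cylinder_nil_inf_eq_bot (hβ β' hβ') hpre),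
      mul_zero]
    exact zero_mem _

theorem mem_monomialSpan_of_mul_sWord_eq_zero {β : List 𝒜}
    (hx : x ∈ monomialSpan R X K (insert β L)) (h : x * S β = 0) : x ∈ monomialSpan R X K L := by
  obtain ⟨d, -, y, hy, rfl⟩ := exists_of_mem_monomialSpan_insert_right hx
  have hd : d * S⋆ β = -(y * P (cylinder X [] β)) := by
    rw [← sWord_mul_sStarWord, eq_neg_iff_add_eq_zero]
    calc d * S⋆ β + y * (S β * S⋆ β) = (d * S⋆ β + y) * S β * S⋆ β := by
          nth_rw 1 [← (isGeneralizedInverse_word R X β).2]; simp only [add_mul, mul_assoc]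
      _ = 0 := by rw [h, zero_mul]
  rw [hd]
  exact add_mem (neg_mem (mul_p_mem _ hy)) hy

theorem exists_mul_right_mem (hx : x ≠ 0) :
    ∃ b, x * b ≠ 0 ∧ x * b ∈ monomialSpan R X .univ {[]} := by
  classical
  obtain ⟨K, L, -, -, hL⟩ := exists_finset_mem_monomialSpan
    (monomialSpan_univ_univ R X ▸ Submodule.mem_top : x ∈ monomialSpan R X .univ .univ)
  replace hL := monomialSpan_mono (Set.subset_univ _) subset_rfl hL
  induction L using Finset.induction_on_max_value (List.length (α := 𝒜)) with
  | empty => exact absurd (by simpa [monomialSpan] using hL) hx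
  | insert β L _ hmax ih =>
    by_cases h : x * S β = 0
    · rw [Finset.coe_insert] at hL
      exact ih (mem_monomialSpan_of_mul_sWord_eq_zero hL h)
    · exact ⟨S β, h, mul_sWord_mem (by simpa using hmax) hL⟩

theorem sStarWord_mul_mem {α : List 𝒜} (hα : α ∉ K) (hK : ∀ β ∈ K, α.length ≤ β.length)
    (hx : x ∈ monomialSpan R X K {[]}) : S⋆ α * x ∈ monomialSpan R X {[]}ᶜ {[]} := by
  refine mul_left_mem_of_mem_span ?_ hx
  rintro _ ⟨β, hβ, A, _, rfl, rfl⟩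
  rw [sStarWord_nil, mul_one]
  by_cases hpre : α <+: β
  · obtain ⟨γ, rfl⟩ := hpre
    have hγ : γ ≠ [] := by
      rintro rfl
      exact hα (List.append_nil α ▸ hβ)
    rw [← mul_assoc, sStarWord_mul_sWord_append, mul_assoc, ← p_inf]
    exact sWord_mul_p_mem R hγ _
  · rw [← mul_assoc, sStarWord_mul_sWord_eq_zero R (cylinder_nil_inf_eq_bot (hK β hβ) hpre),
      zero_mul]
    exact zero_mem _

theorem exists_mul_left_eq_add (hx : x ≠ 0) (hmem : x ∈ monomialSpan R X .univ {[]}) :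
    ∃ a, ∃ d ∈ monomialSpan R X {[]} {[]}, ∃ n ∈ monomialSpan R X {[]}ᶜ {[]},
      a * x = d + n ∧ d ≠ 0 := by
  classical
  obtain ⟨K, L, -, hL, hK⟩ := exists_finset_mem_monomialSpan hmem
  replace hK := monomialSpan_mono subset_rfl hL hK
  induction K using Finset.induction_on_min_value (List.length (α := 𝒜)) generalizing x with
  | empty => exact absurd (by simpa [monomialSpan] using hK) hx
  | insert α K hα hmin ih =>
    rw [Finset.coe_insert] at hK
    obtain ⟨d, hd, x', hx', rfl⟩ := exists_of_mem_monomialSpan_insert_left hK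
    by_cases h : S⋆ α * S α * d = 0
    · have hαd : S α * d = 0 := by
        rw [← (isGeneralizedInverse_word R X α).1, mul_assoc (S α), mul_assoc, h, mul_zero]
      rw [hαd, zero_add] at hx ⊢
      exact ih hx (monomialSpan_mono (Set.subset_univ _) subset_rfl hx') hx'
    · refine ⟨S⋆ α, S⋆ α * S α * d, ?_, S⋆ α * x', ?_, by rw [mul_add, mul_assoc], h⟩
      · rw [sStarWord_mul_sWord]
        exact p_mul_mem _ hd
      · exact sStarWord_mul_mem hα hmin hx'

theorem exists_mul_mul_eq_smul_p_add (hx : x ≠ 0) :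
    ∃ a b, ∃ c : R, c ≠ 0 ∧ ∃ B : U X, (B : Set X).Nonempty ∧
      ∃ n ∈ monomialSpan R X {[]}ᶜ {[]}, a * x * b = c • P B + n := by
  obtain ⟨b, hb, hbmem⟩ := exists_mul_right_mem hx
  obtain ⟨a, d, hd, n, hn, hadn, hd0⟩ := exists_mul_left_eq_add hb hbmem
  obtain ⟨B, -, hdB, c, hc⟩ := exists_mul_p_eq_smul hd (z := d) (B := ⊤) (by rwa [p_top, mul_one])
  have hc0 : c ≠ 0 := by
    rintro rfl
    exact hdB (by rw [hc, zero_smul])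
  have hB : (B : Set X).Nonempty := by
    rw [Set.nonempty_iff_ne_empty]
    intro hB
    exact hdB (by rw [show B = ⊥ from Subtype.ext hB, p_bot, mul_zero])
  refine ⟨a, b * P B, c, hc0, B, hB, n * P B, mul_p_mem B hn, ?_⟩
  rw [← hc, ← add_mul, ← hadn]
  simp only [mul_assoc]

theorem exists_p_mul_mul_p_eq_zero {Γ : Set (List 𝒜)} (hΓ : Γ.Finite)
    {n : UnitalSubshiftAlgebra R X} (hn : n ∈ monomialSpan R X Γ {[]}) {B : U X} {y : X}
    (hy : y ∈ (B : Set X)) (hne : ∀ γ ∈ Γ, γ ++ₛ (y : Stream' 𝒜) ≠ y) :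
    ∃ D ≤ B, y ∈ (D : Set X) ∧ P D * n * P D = 0 := by
  obtain ⟨k, hk⟩ := exists_forall_take_ne (hΓ.image (· ++ₛ (y : Stream' 𝒜)))
    (y := y) (by rintro ⟨γ, hγ, h⟩; exact hne γ hγ h)
  set D : U X := B ⊓ cylinder X [] ((y : Stream' 𝒜).take k)
  refine ⟨D, inf_le_left, ⟨hy, mem_cylinder_take.2 rfl⟩, ?_⟩
  induction hn using Submodule.span_induction with
  | mem n hn =>
    obtain ⟨γ, hγ, A, _, rfl, rfl⟩ := hn
    have hpre : pre γ D ⊓ D = ⊥ :=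
      pre_inf_self_eq_bot (fun z hz => mem_cylinder_take.1 hz.2) (hk _ ⟨γ, hγ, rfl⟩)
    rw [sStarWord_nil, mul_one, ← mul_assoc, p_mul_sWord, mul_assoc, mul_assoc, ← p_inf, ← p_inf,
      inf_left_comm, hpre, inf_bot_eq, p_bot, mul_zero]
  | zero => rw [mul_zero, zero_mul]
  | add m n _ _ hm hn => rw [mul_add, add_mul, hm, hn, add_zero]
  | smul c n _ hn => rw [mul_smul_comm, smul_mul_assoc, hn, smul_zero]

/-- The second alternative occurs only for a finite set of isolated periodic points, where the
matrix coefficient takes the place of the nonzero scalar. -/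
theorem exists_mul_mul_eq_smul_p_or_periodic (hx : x ≠ 0) : ∃ a b,
    (∃ c : R, c ≠ 0 ∧ ∃ D : U X, (D : Set X).Nonempty ∧ a * x * b = c • P D) ∨
    ∃ (y : X) (A : U X), (A : Set X) = {y} ∧ IsPeriodic (y : Stream' 𝒜) ∧
      P A * (a * x * b) = a * x * b ∧ coeffAt R X y (a * x * b) ≠ 0 := by
  obtain ⟨a, b, c, hc, B, ⟨y₀, hy₀⟩, n, hn, hab⟩ := exists_mul_mul_eq_smul_p_add hx
  obtain ⟨Γ, L, hΓ, hL, hnΓ⟩ := exists_finset_mem_monomialSpan hn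
  replace hnΓ := monomialSpan_mono subset_rfl hL hnΓ
  by_cases hy : ∃ y ∈ (B : Set X), ∀ γ ∈ Γ, γ ++ₛ (y : Stream' 𝒜) ≠ y
  · obtain ⟨y, hyB, hy⟩ := hy
    obtain ⟨D, hDB, hyD, hD⟩ := exists_p_mul_mul_p_eq_zero Γ.finite_toSet hnΓ hyB hy
    refine ⟨P D * a, b * P D, .inl ⟨c, hc, D, ⟨y, hyD⟩, ?_⟩⟩
    calc P D * a * x * (b * P D) = P D * (a * x * b) * P D := by simp only [mul_assoc]
      _ = c • (P D * P B * P D) + P D * n * P D := by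
          rw [hab, mul_add, add_mul, mul_smul_comm, smul_mul_assoc]
      _ = c • P D := by rw [hD, p_mul_of_le R hDB, p_mul_self, add_zero]
  · push Not at hy
    have hB : (B : Set X).Finite :=
      Set.Finite.of_finite_image ((finite_setOf_append_eq_self Γ.finite_toSet
        fun h => hΓ h rfl).subset (Set.image_subset_iff.2 hy)) Subtype.val_injective.injOn
    obtain ⟨A, hA⟩ := exists_coe_eq_singleton hB hy₀
    obtain ⟨γ, hγ, hγy⟩ := hy y₀ hy₀
    refine ⟨P A * a, b, .inr ⟨y₀, A, hA, ⟨γ, hΓ hγ, hγy⟩, ?_, fun h => hc ?_⟩⟩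
    · simp only [← mul_assoc, p_mul_self]
    · have h0 := congrArg (fun f : LaurentPolynomial R => f.coeff 0) h
      rw [mul_assoc (P A), mul_assoc (P A), coeffAt_p_mul R hA, hab, map_add, map_smul,
        coeffAt_p R hy₀] at h0
      simpa [coeff_zero_coeffAt y₀ hn, ← LaurentPolynomial.T_zero] using h0

end Reduction

section MinimalIdeals

open LaurentPolynomial

variable {R : Type u} {𝒜 : Type v} {X : Set (Stream' 𝒜)}

theorem one_sub_T_ne_zero [CommRing R] [Nontrivial R] {n : ℤ} (hn : n ≠ 0) :
    (1 - T n : R[T;T⁻¹]) ≠ 0 := by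
  intro h
  simpa [← T_zero, hn] using congrArg (fun f : R[T;T⁻¹] => f.coeff 0) h

theorem mul_one_sub_T_ne_one [CommRing R] [Nontrivial R] (f : R[T;T⁻¹]) (n : ℕ) :
    f * (1 - T n) ≠ 1 := by
  intro h
  have heval := congrArg (eval₂ (RingHom.id R) 1) h
  rw [map_mul, map_sub, eval₂_T_n] at heval
  simp at heval

theorem inf_eq_bot_or_eq_of_subsingleton {A : U X} (hA : (A : Set X).Subsingleton) (B : U X) :
    A ⊓ B = ⊥ ∨ A ⊓ B = A := by
  refine or_iff_not_imp_left.2 fun h => inf_eq_left.2 fun x hx => ?_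
  obtain ⟨y, hy, hyB⟩ := Set.nonempty_iff_ne_empty.2 fun h0 => h (Subtype.ext h0)
  exact hA hx hy ▸ hyB

variable [IsShiftInvariant X]

/-- Evaluating the matrix coefficients at `T = 1` shows that `1 - s_γ` generates a proper
subideal. -/
theorem not_isAtom_span_of_isPeriodic [CommRing R] [IsDomain R] {y : X} {A : U X}
    (hA : (A : Set X) = {y}) (hy : IsPeriodic (y : Stream' 𝒜)) {f : UnitalSubshiftAlgebra R X}
    (hf : p R X A * f = f) (hf0 : coeffAt R X y f ≠ 0) : ¬IsAtom (Ideal.span {f}) := by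
  obtain ⟨γ, hγ, hγy⟩ := hy
  have hcoeff (w : UnitalSubshiftAlgebra R X) :
      coeffAt R X y (w * (p R X A * (1 - sWord R X γ) * f)) =
        coeffAt R X y w * (1 - T γ.length) * coeffAt R X y f := by
    rw [← hf, ← mul_assoc, ← mul_assoc, ← mul_assoc, coeffAt_mul_p_mul R hA,
      coeffAt_mul_p_mul R hA, map_sub, coeffAt_one, coeffAt_sWord R hγy, hf]
  intro hatom
  obtain ⟨w, hw⟩ := (isAtom_span_singleton_iff.1 hatom).2 (p R X A * (1 - sWord R X γ)) fun h0 => by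
    have h := hcoeff 1
    rw [h0, mul_zero, map_zero, coeffAt_one, one_mul] at h
    exact mul_ne_zero (one_sub_T_ne_zero (by simpa using hγ)) hf0 h.symm
  refine mul_one_sub_T_ne_one (coeffAt R X y w) γ.length (mul_right_cancel₀ hf0 ?_)
  rw [← hcoeff, hw, one_mul]

theorem isAtom_of_isAtom_span_p [CommRing R] [Nontrivial R] {D : U X}
    (hD : IsAtom (Ideal.span {p R X D})) : IsAtom D := by
  obtain ⟨hD0, hD⟩ := isAtom_span_singleton_iff.1 hD
  refine isAtom_iff_le_of_ge.2 ⟨fun h => hD0 (by rw [h, p_bot]), fun B hB hBD => ?_⟩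
  obtain ⟨y, hy⟩ := Set.nonempty_iff_ne_empty.2 fun h => hB (Subtype.ext h)
  obtain ⟨w, hw⟩ := hD (p R X B) (by rw [p_mul_of_le R hBD]; exact p_ne_zero R hy)
  have hDB : p R X (D ⊓ Bᶜ) = 0 := by
    rw [p_inf, p_compl, ← hw, p_mul_of_le R hBD, mul_sub, mul_one, mul_assoc, p_mul_self, sub_self]
  intro z hz
  by_contra hzB
  exact p_ne_zero R (A := D ⊓ Bᶜ) (y := z) ⟨hz, hzB⟩ hDB

theorem exists_coe_eq_singleton_of_isAtom {D : U X} (hD : IsAtom D) :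
    ∃ y : X, (D : Set X) = {y} := by
  obtain ⟨y, hy⟩ := Set.nonempty_iff_ne_empty.2 fun h => hD.1 (Subtype.ext h)
  refine ⟨y, Set.eq_singleton_iff_unique_mem.2 ⟨hy, fun z hz => ?_⟩⟩
  have hDk (k : ℕ) : D ≤ cylinder X [] ((y : Stream' 𝒜).take k) :=
    hD.not_disjoint_iff_le.1 fun hdisj =>
      (disjoint_iff.1 hdisj).le ⟨hy, mem_cylinder_take.2 rfl⟩
  exact Subtype.ext (Stream'.take_theorem _ _ fun k => mem_cylinder_take.1 (hDk k hz))

theorem mem_irrationalPaths_iff {A : U X} : A ∈ irrationalPaths X ↔ ∃ y : X, (A : Set X) = {y} ∧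
    ∀ (α : List 𝒜) (x : Stream' 𝒜), (y : Stream' 𝒜) = α ++ₛ x → ¬IsPeriodic x := by
  refine exists_congr fun y => and_congr_right fun _ => ⟨?_, fun h α _ β _ hβ hy => ?_⟩
  · rintro h α x hy ⟨γ, hγ, hγx⟩
    have hx : x ∈ X := mem_of_append_mem (hy ▸ y.2)
    refine h α (mem_language_iff.2 ⟨x, hy ▸ y.2⟩) γ (mem_language_iff.2 ⟨x, hγx.symm ▸ hx⟩) hγ ?_
    rw [hy, eq_of_append_eq_self hγ hγx (Stream'.cycle_eq γ hγ).symm]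
  · exact h α _ hy (isPeriodic_cycle β hβ)

theorem pre_inf_pre_eq_bot {A : U X} (hA : A ∈ irrationalPaths X) {α β : List 𝒜} (h : α ≠ β) :
    pre α A ⊓ pre β A = ⊥ := by
  wlog hl : α.length ≤ β.length generalizing α β
  · rw [inf_comm]
    exact this h.symm (le_of_not_ge hl)
  obtain ⟨y, hAy, hirr⟩ := mem_irrationalPaths_iff.1 hA
  refine Subtype.ext (Set.eq_empty_of_forall_notMem ?_)
  rintro x ⟨hα, hβ⟩
  obtain ⟨z, hz, hzα⟩ := mem_pre.1 hα
  obtain ⟨z', hz', hzβ⟩ := mem_pre.1 hβ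
  rw [hAy, Set.mem_singleton_iff] at hz hz'
  subst hz hz'
  obtain ⟨γ, rfl, hγ⟩ := exists_eq_append_of_append_eq (hzα.symm.trans hzβ) hl
  exact hirr α x hzα ⟨γ, fun hnil => h (by rw [hnil, List.append_nil]), hγ.symm⟩

theorem subsingleton_pre {A : U X} (hA : (A : Set X).Subsingleton) (α : List 𝒜) :
    (pre α A : Set X).Subsingleton := by
  intro x hx x' hx'
  obtain ⟨y, hy, hyx⟩ := mem_pre.1 hx
  obtain ⟨y', hy', hyx'⟩ := mem_pre.1 hx'
  rw [hA hy' hy, hyx] at hyx'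
  exact Subtype.ext (Stream'.append_right_injective α _ _ hyx')

variable [HasFullAlphabet X]

theorem p_mul_monomial_mul_p [CommRing R] (A B : U X) (α β : List 𝒜) :
    p R X A * (sWord R X α * p R X B * sStarWord R X β) * p R X A =
      sWord R X α * p R X (pre α A ⊓ pre β A ⊓ B) * sStarWord R X β := by
  calc p R X A * (sWord R X α * p R X B * sStarWord R X β) * p R X A =
        p R X A * sWord R X α * p R X B * (sStarWord R X β * p R X A) := by simp only [mul_assoc]
    _ = sWord R X α * (p R X (pre α A) * p R X B * p R X (pre β A)) * sStarWord R X β := by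
        rw [p_mul_sWord, sStarWord_mul_p]; simp only [mul_assoc]
    _ = _ := by rw [← p_inf, ← p_inf, inf_right_comm]

theorem exists_p_mul_monomial_mul_p_eq_smul [CommRing R] {A : U X}
    (hA : (A : Set X).Subsingleton) (B : U X) (α : List 𝒜) : ∃ c : R,
      p R X A * (sWord R X α * p R X B * sStarWord R X α) * p R X A = c • p R X A := by
  rw [p_mul_monomial_mul_p, inf_idem]
  obtain hB | hB := inf_eq_bot_or_eq_of_subsingleton (subsingleton_pre hA α) B
  · exact ⟨0, by rw [hB, p_bot, mul_zero, zero_mul, zero_smul]⟩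
  rw [hB, ← p_mul_sWord, mul_assoc, sWord_mul_sStarWord, ← p_inf]
  obtain hα | hα := inf_eq_bot_or_eq_of_subsingleton hA (cylinder X [] α)
  · exact ⟨0, by rw [hα, p_bot, zero_smul]⟩
  · exact ⟨1, by rw [hα, one_smul]⟩

theorem exists_p_mul_mul_p_eq_smul [CommRing R] {A : U X} (hA : A ∈ irrationalPaths X)
    (x : UnitalSubshiftAlgebra R X) : ∃ c : R, p R X A * x * p R X A = c • p R X A := by
  have hx : x ∈ monomialSpan R X .univ .univ := monomialSpan_univ_univ R X ▸ Submodule.mem_top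
  induction hx using Submodule.span_induction with
  | mem x hx =>
    obtain ⟨α, -, B, β, -, rfl⟩ := hx
    by_cases h : α = β
    · obtain ⟨y, hAy, -⟩ := hA
      exact h ▸ exists_p_mul_monomial_mul_p_eq_smul (hAy ▸ Set.subsingleton_singleton) B α
    · refine ⟨0, ?_⟩
      rw [p_mul_monomial_mul_p, pre_inf_pre_eq_bot hA h, bot_inf_eq, p_bot, mul_zero, zero_mul,
        zero_smul]
  | zero => exact ⟨0, by rw [mul_zero, zero_mul, zero_smul]⟩
  | add a b _ _ ha hb =>
    obtain ⟨c, hc⟩ := ha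
    obtain ⟨d, hd⟩ := hb
    exact ⟨c + d, by rw [mul_add, add_mul, hc, hd, add_smul]⟩
  | smul c a _ ha =>
    obtain ⟨d, hd⟩ := ha
    exact ⟨c * d, by rw [mul_smul_comm, smul_mul_assoc, hd, mul_smul]⟩

theorem exists_mul_mul_ne_zero [CommRing R] [IsDomain R] {x : UnitalSubshiftAlgebra R X}
    (hx : x ≠ 0) : ∃ w, x * w * x ≠ 0 := by
  obtain ⟨a, b, h⟩ := exists_mul_mul_eq_smul_p_or_periodic hx
  suffices hsq : (a * x * b) * (a * x * b) ≠ 0 by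
    refine ⟨b * a, fun h0 => hsq ?_⟩
    calc (a * x * b) * (a * x * b) = a * (x * (b * a) * x) * b := by simp only [mul_assoc]
      _ = 0 := by rw [h0, mul_zero, zero_mul]
  intro h0
  obtain ⟨c, hc, D, ⟨y, hy⟩, h⟩ | ⟨y, A, hA, -, hf, hf0⟩ := h
  · have hcoeff : c * c = 0 := by
      have hcc := congrArg (fun z => (coeffAt R X y z).coeff 0) h0
      simpa [h, smul_mul_smul_comm, p_mul_self, coeffAt_p R hy, ← T_zero] using hcc
    exact mul_ne_zero hc hc hcoeff
  · refine mul_ne_zero hf0 hf0 ?_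
    rw [← coeffAt_mul_p_mul R hA, mul_assoc, hf, h0, map_zero]

theorem isAtom_span_p_iff [Field R] {D : U X} :
    IsAtom (Ideal.span {p R X D}) ↔ D ∈ irrationalPaths X := by
  refine ⟨fun hatom => ?_, fun hD => ?_⟩
  · obtain ⟨y, hDy⟩ := exists_coe_eq_singleton_of_isAtom (isAtom_of_isAtom_span_p hatom)
    refine mem_irrationalPaths_iff.2 ⟨y, hDy, fun α x hyx hx => ?_⟩
    lift x to X using mem_of_append_mem (hyx ▸ y.2)
    have hxD : x ∈ (pre α D : Set X) := mem_pre.2 ⟨y, hDy ▸ rfl, hyx⟩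
    have hpre : (pre α D : Set X) = {x} :=
      (subsingleton_pre (hDy ▸ Set.subsingleton_singleton) α).eq_singleton_of_mem hxD
    obtain ⟨e⟩ := nonempty_linearEquiv_span_mul_mul hatom (Ideal.mem_span_singleton_self _)
      (a := sStarWord R X α) (b := sWord R X α)
      (by rw [sStarWord_mul_p_mul_sWord]; exact p_ne_zero R hxD)
    rw [sStarWord_mul_p_mul_sWord] at e
    refine not_isAtom_span_of_isPeriodic hpre hx (p_mul_self R X _) ?_
      ((isAtom_iff_of_linearEquiv e).1 hatom)
    rw [coeffAt_p R hxD]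
    exact one_ne_zero
  · obtain ⟨y, hDy, -⟩ := id hD
    exact isAtom_span_of_corner (fun _ => exists_mul_mul_ne_zero)
      (p_ne_zero R (y := y) (hDy ▸ rfl)) (exists_p_mul_mul_p_eq_smul (R := R) hD)

theorem exists_irrationalPaths_linearEquiv [Field R] {I : Ideal (UnitalSubshiftAlgebra R X)}
    (hI : IsAtom I) : ∃ A ∈ irrationalPaths X,
      Nonempty (I ≃ₗ[UnitalSubshiftAlgebra R X] Ideal.span {p R X A}) := by
  obtain ⟨x, hxI, hx⟩ := Submodule.exists_mem_ne_zero_of_ne_bot hI.1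
  obtain ⟨a, b, ⟨c, hc, D, ⟨y, hy⟩, h⟩ | ⟨y, A, hA, hy, hf, hf0⟩⟩ :=
    exists_mul_mul_eq_smul_p_or_periodic hx
  · have hD : (c⁻¹ • a) * x * b = p R X D := by
      rw [smul_mul_assoc, smul_mul_assoc, h, inv_smul_smul₀ hc]
    have e := nonempty_linearEquiv_span_mul_mul hI hxI
      (show (c⁻¹ • a) * x * b ≠ 0 from hD.trans_ne (p_ne_zero R hy))
    rw [hD] at e
    exact ⟨D, isAtom_span_p_iff.1 ((isAtom_iff_of_linearEquiv e.some).1 hI), e⟩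
  · obtain ⟨e⟩ := nonempty_linearEquiv_span_mul_mul hI hxI (a := a) (b := b)
      fun h0 => hf0 (by rw [h0, map_zero])
    exact absurd ((isAtom_iff_of_linearEquiv e).1 hI) (not_isAtom_span_of_isPeriodic hA hy hf hf0)

end MinimalIdeals

end SubshiftAlgebra

theorem mainTheorem3_general {R : Type*} [Field R] {𝒜 : Type*} {X : Set (Stream' 𝒜)}
    (hX : ∀ x ∈ X, x.tail ∈ X) (hL : ∀ a : 𝒜, [a] ∈ SubshiftAlgebra.language X)
    (I : Ideal (SubshiftAlgebra.UnitalSubshiftAlgebra R X)) :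
    IsAtom I ↔ ∃ A ∈ SubshiftAlgebra.irrationalPaths X,
      Nonempty (I ≃ₗ[SubshiftAlgebra.UnitalSubshiftAlgebra R X]
        Ideal.span {SubshiftAlgebra.p R X A}) := by
  have : SubshiftAlgebra.IsShiftInvariant X := ⟨hX⟩
  have : SubshiftAlgebra.HasFullAlphabet X := ⟨hL⟩
  refine ⟨SubshiftAlgebra.exists_irrationalPaths_linearEquiv, fun ⟨A, hA, ⟨e⟩⟩ => ?_⟩
  exact (SubshiftAlgebra.isAtom_iff_of_linearEquiv e).2 (SubshiftAlgebra.isAtom_span_p_iff.2 hA)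

theorem mainTheorem3 {R : Type*} [Field R] {𝒜 : Type*} (F : Set (List 𝒜))
    (hF : ∀ a : 𝒜, [a] ∈ SubshiftAlgebra.language (SubshiftAlgebra.subshift F))
    (I : Ideal (SubshiftAlgebra.UnitalSubshiftAlgebra R (SubshiftAlgebra.subshift F))) :
    IsAtom I ↔
      ∃ A ∈ SubshiftAlgebra.irrationalPaths (SubshiftAlgebra.subshift F),
        Nonempty
          (I ≃ₗ[SubshiftAlgebra.UnitalSubshiftAlgebra R (SubshiftAlgebra.subshift F)]
            Ideal.span {SubshiftAlgebra.p R (SubshiftAlgebra.subshift F) A}) :=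
  mainTheorem3_general (fun x hx k n => by
    have := hx (k + 1) n; rwa [← Stream'.drop_tail'] at this) hF I
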